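/- Let $\omega=(-1+\sqrt{-3})/2$. An element $u+v\omega\in\mathbb Z[\omega]$ ($u,v\in\mathbb Z$) is called primary if $3\mid u-2$ and $3\mid v$, and its norm is $N(u+v\omega)=u^2-uv+v^2$. For a primary prime $\pi$ of $\mathbb Z[\omega]$ and $\alpha\in\mathbb Z[\omega]$ let $\left(\frac{\alpha}{\pi}\right)_3=0$ if $\pi\mid\alpha$, and otherwise let $\left(\frac{\alpha}{\pi}\right)_3=\omega^i$ be the cube root of unity with $\alpha^{(N(\pi)-1)/3}\equiv\omega^i\pmod{\pi}$. For $\beta=u+v\omega\in\mathbb Z[\omega]$ with $3\nmid u$ and $3\mid v$ write $\beta=\pm\pi_1\cdots\pi_r$ with primary primes $\pi_1,\dots,\pi_r$ ($r\ge 0$), and define the cubic Jacobi symbol by $\left(\frac{\alpha}{\beta}\right)_3=\left(\frac{\alpha}{\pi_1}\right)_3\cdots\left(\frac{\alpha}{\pi_r}\right)_3$; in particular $\left(\frac{\alpha}{\pm1}\right)_3=1$. **Theorem 2.1.** Let $P,D\in\mathbb Z$ with $3\nmid P$ or $27\mid P$. Suppose that $Q=P^2+27D=2^{q_1}q_0^3$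 with $q_0\in\mathbb Z$ and $q_1\in\{0,1,2\}$. Let $a,b,c,x,y\in\mathbb Z$ be such that $b^2-ac=D$ and $\gcd\bigl(a(ax^2+2bxy+cy^2),\,3DQy\bigr)=1$. Then $$\left(\frac{Py+3(ax+by)(1+2\omega)}{ax^2+2bxy+cy^2}\right)_3=\left(\frac{P-3b(1+2\omega)}{a}\right)_3 .$$ -/

import Mathlib

/-- The ring `ℤ[ω]` with `ω = (-1 + √-3) / 2`, i.e. the elements `re + im * ω` with `re`, `im`
integers, multiplied by the rule `ω ^ 2 = -1 - ω`. -/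
abbrev EisensteinRing : Type := QuadraticAlgebra ℤ (-1) (-1)

namespace EisensteinRing

/-- The element `ω = 0 + 1 * ω`. -/
def w : EisensteinRing := ⟨0, 1⟩

theorem w_sq_add_w_add_one : w ^ 2 + w + 1 = 0 := by
  decide

/-- Mathlib's norm on this ring is `N(a + b ω) = a ^ 2 - a b + b ^ 2`. -/
theorem norm_eq (z : EisensteinRing) :
    QuadraticAlgebra.norm z = z.re ^ 2 - z.re * z.im + z.im ^ 2 := by
  rw [QuadraticAlgebra.norm_def]; ring

/-- `a + b ω` is primary when `a + b ω ≡ 2 (mod 3)`, i.e. `3 ∣ a - 2` and `3 ∣ b`. -/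
def IsPrimary (z : EisensteinRing) : Prop :=
  (3 : ℤ) ∣ z.re - 2 ∧ (3 : ℤ) ∣ z.im

open Classical in
/-- The cubic residue character of `α` modulo a primary prime `π`: it is `0` if `π ∣ α`, and
otherwise the cube root of unity `ω ^ i` with `α ^ ((N(π) - 1) / 3) ≡ ω ^ i (mod π)`.
(The last branch is never reached when `π` is a primary prime.) -/
noncomputable def cubicChar (α π : EisensteinRing) : EisensteinRing :=
  if π ∣ α then 0
  else if π ∣ α ^ (((QuadraticAlgebra.norm π).natAbs - 1) / 3) - 1 then 1
  else if π ∣ α ^ (((QuadraticAlgebra.norm π).natAbs - 1) / 3) - w then w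
  else if π ∣ α ^ (((QuadraticAlgebra.norm π).natAbs - 1) / 3) - w ^ 2 then w ^ 2
  else 0

/-- `s` is a factorization of `β` up to sign into primary primes: `β = ± π₁ ⋯ πᵣ`.
The case `r = 0` is that of `β = ± 1`. -/
def IsPrimaryFactorization (β : EisensteinRing) (s : Multiset EisensteinRing) : Prop :=
  (∀ π ∈ s, Prime π ∧ IsPrimary π) ∧ (β = s.prod ∨ β = -s.prod)

open Classical in
/-- The cubic Jacobi symbol of `α` over `β = ± π₁ ⋯ πᵣ`, with primary primes `πⱼ`: the product of
the cubic residue characters of `α` modulo the `πⱼ`. The factorization exists exactly when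
`β ≡ ± 2 (mod 3)`, and it is unique up to order. The symbol over `± 1` is the empty product `1`;
outside its domain the symbol is given the value `0`. -/
noncomputable def cubicJacobi (α β : EisensteinRing) : EisensteinRing :=
  if h : ∃ s : Multiset EisensteinRing, IsPrimaryFactorization β s then
    (h.choose.map (cubicChar α)).prod
  else 0

end EisensteinRing

/-! Put `θ = 1 + 2ω = √-3`, `z = ax + by`, `f = ax² + 2bxy + cy²` and `n = af = z² - Dy²`. Modulo
`a` the element `α = Py + 3zθ` is `y` times the conjugate of `γ = P - 3bθ`, so
`(α/a)₃ = (γ/a)₃⁻¹`, and the theorem is equivalent to `(α/n)₃ = 1`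
(`cubicJacobi_add_three_mul_theta`).

Reciprocity is needed only between a semiprimary element and a rational integer
(`cubicJacobi_intCast_right`). For primary primes `π`, `l`, the Gauss sum `g` of the cubic character
of `π` is formed over an extension of the residue field of `l`. It satisfies `g³ = N(π) π`, because
the Jacobi sum of the character with itself equals `π` (`jacobiSum_residueChar`), and
`g ^ N(l) = χ_π(N(l))⁻¹ g`; together these give `χ_l(N(π) π) χ_π(N(l)) = 1`
(`cubicChar_norm_mul_cubicChar`). Taking the product over the primary primes `l` dividing a rational
integer `n` yields `(π/n)₃ = (n/π)₃`. Symbols `(m/n)₃` of coprime rational integers, and likewise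
`(θ/n)₃`, are `1`, since they are cube roots of unity fixed by conjugation.

For the evaluation of `(α/n)₃`, suppose that `α` is a semiprimary `β` times powers of `3` and `θ`.
Then `(α/n)₃ = (β/n)₃ = (n/β)₃`. As `N(α) = 27n + Qy²`, this is `(Qy²/β)₃`, in which `q₀³` does not
count, just as the cube `27`, and the factors `2` and `y` are removed by a second use of reciprocity
(`cubicJacobi_eq_one_of_eq_mul_semiprimary`). When `3` divides `y` one needs `(θ/β)₃ = 1` as well;
this holds for `β = u + vθ` with `3 ∤ u` and `9 ∣ v` (`cubicJacobi_theta_eq_one`).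

In the remaining cases, `3 ∤ P` with `3 ∣ y`, and `27 ∣ P ≠ 0` with `3 ∣ z`, the element `z + y√D`
is multiplied by a suitable `z₀ + √D`. The symbol is multiplicative under this operation
(`cubicJacobi_eq_one_of_composition`), and both the auxiliary element and the product fall under the
evaluation above. If `P = 0`, then `α` is a rational multiple of `θ`. -/

namespace EisensteinRing

open QuadraticAlgebra

local notation "nrm" => (QuadraticAlgebra.norm : EisensteinRing →* ℤ)

/-! ### The Euclidean domain `ℤ[ω]` -/

@[simp] theorem w_re : w.re = 0 := rfl

@[simp] theorem w_im : w.im = 1 := rfl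

theorem w_sq : w ^ 2 = -1 - w := by decide

theorem w_cube : w ^ 3 = 1 := by decide

theorem four_mul_norm (z : EisensteinRing) :
    4 * nrm z = (2 * z.re - z.im) ^ 2 + 3 * z.im ^ 2 := by
  rw [norm_eq]; ring

theorem norm_nonneg (z : EisensteinRing) : 0 ≤ nrm z := by
  have := four_mul_norm z
  nlinarith [sq_nonneg (2 * z.re - z.im), sq_nonneg z.im]

theorem norm_eq_zero_iff {z : EisensteinRing} : nrm z = 0 ↔ z = 0 := by
  refine ⟨fun h => ?_, fun h => by rw [h]; simp⟩
  have h4 := four_mul_norm z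
  have him : z.im = 0 := by
    have : z.im ^ 2 = 0 := by nlinarith [sq_nonneg (2 * z.re - z.im), sq_nonneg z.im]
    simpa using this
  have hre : z.re = 0 := by
    have : z.re ^ 2 = 0 := by rw [him] at h4; nlinarith
    simpa using this
  exact QuadraticAlgebra.ext hre him

theorem norm_pos {z : EisensteinRing} (hz : z ≠ 0) : 0 < nrm z :=
  lt_of_le_of_ne (norm_nonneg z) fun h => hz (norm_eq_zero_iff.1 h.symm)

theorem mul_star_eq_norm (z : EisensteinRing) : z * star z = ((nrm z : ℤ) : EisensteinRing) := by
  rw [QuadraticAlgebra.ext_iff, re_intCast, im_intCast, norm_eq]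
  constructor
  · simp [re_mul]; ring
  · simp [im_mul]; ring

instance : IsDomain EisensteinRing :=
  have : NoZeroDivisors EisensteinRing :=
    ⟨fun {a b} h => by
      have := congrArg nrm h
      rw [map_mul, QuadraticAlgebra.norm_zero, mul_eq_zero] at this
      exact this.imp norm_eq_zero_iff.1 norm_eq_zero_iff.1⟩
  NoZeroDivisors.to_isDomain _

/-- The rounded quotient `q` of `a` by `b ≠ 0`: the coordinates of `a * star b / N b`, each
rounded to a nearest integer. -/
def quot (a b : EisensteinRing) : EisensteinRing :=
  ⟨(2 * (a * star b).re + nrm b) / (2 * nrm b), (2 * (a * star b).im + nrm b) / (2 * nrm b)⟩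

theorem norm_sub_mul_quot_lt (a : EisensteinRing) {b : EisensteinRing} (hb : b ≠ 0) :
    nrm (a - b * quot a b) < nrm b := by
  have hN := norm_pos hb
  set N := nrm b with hNdef
  have key : nrm (a - b * quot a b) * N = nrm (a * star b - N * quot a b) := by
    have : (a - b * quot a b) * star b = a * star b - N * quot a b := by
      rw [sub_mul, mul_right_comm, mul_star_eq_norm]
    rw [← this, map_mul, QuadraticAlgebra.norm_star]
  -- rounding leaves remainders of absolute value at most `N / 2` in each coordinate
  have round (t : ℤ) : -N ≤ 2 * (t - N * ((2 * t + N) / (2 * N))) ∧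
      2 * (t - N * ((2 * t + N) / (2 * N))) ≤ N := by
    have h1 := Int.emod_add_mul_ediv (2 * t + N) (2 * N)
    have h2 := Int.emod_nonneg (2 * t + N) (show 2 * N ≠ 0 by lia)
    have h3 := Int.emod_lt_of_pos (2 * t + N) (show 0 < 2 * N by lia)
    constructor <;> nlinarith
  obtain ⟨h1, h2⟩ := round (a * star b).re
  obtain ⟨h3, h4⟩ := round (a * star b).im
  have hre : (a * star b - N * quot a b).re =
      (a * star b).re - N * ((2 * (a * star b).re + N) / (2 * N)) := by
    rw [re_sub, re_mul (N : EisensteinRing)]; simp [quot, N]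
  have him : (a * star b - N * quot a b).im =
      (a * star b).im - N * ((2 * (a * star b).im + N) / (2 * N)) := by
    rw [im_sub, im_mul (N : EisensteinRing)]; simp [quot, N]
  rw [norm_eq (a * star b - N * quot a b), hre, him] at key
  generalize (a * star b).re - N * ((2 * (a * star b).re + N) / (2 * N)) = r at *
  generalize (a * star b).im - N * ((2 * (a * star b).im + N) / (2 * N)) = i at *
  have : nrm (a - b * quot a b) * N < N * N := by
    rw [key]
    nlinarith [mul_nonneg (sub_nonneg.2 h1) (sub_nonneg.2 h2),
      mul_nonneg (sub_nonneg.2 h3) (sub_nonneg.2 h4), sq_nonneg (r + i)]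
  exact lt_of_mul_lt_mul_right this hN.le

/-- `ℤ[ω]` is Euclidean for the norm. -/
@[reducible] def euclideanDomain : EuclideanDomain EisensteinRing :=
  { (inferInstance : CommRing EisensteinRing), (inferInstance : Nontrivial EisensteinRing) with
    quotient := fun a b => if b = 0 then 0 else quot a b
    quotient_zero := fun a => by simp
    remainder := fun a b => a - b * (if b = 0 then 0 else quot a b)
    quotient_mul_add_remainder_eq := fun a b => by ring
    r := fun a b => (nrm a).natAbs < (nrm b).natAbs
    r_wellFounded := (measure fun a : EisensteinRing => (nrm a).natAbs).wf
    remainder_lt := fun a b hb => by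
      have := norm_sub_mul_quot_lt a hb
      have := norm_nonneg (a - b * quot a b)
      simp only [hb, if_false]
      lia
    mul_left_not_lt := fun a b hb => by
      have := norm_pos hb
      have := norm_nonneg a
      rw [map_mul, Int.natAbs_mul, not_lt]
      exact Nat.le_mul_of_pos_right _ (by lia) }

instance : IsPrincipalIdealRing EisensteinRing :=
  @EuclideanDomain.to_principal_ideal_domain _ euclideanDomain

theorem norm_eq_algebra_norm (z : EisensteinRing) : Algebra.norm ℤ z = nrm z := by
  rw [Algebra.norm_apply]
  exact det_toLinearMap_eq_norm z

theorem card_quotient_span (z : EisensteinRing) :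
    Nat.card (EisensteinRing ⧸ Ideal.span {z}) = (nrm z).natAbs := by
  rw [← Submodule.cardQuot_apply, ← Ideal.absNorm_apply, Ideal.absNorm_span_singleton,
    norm_eq_algebra_norm]

/-! ### Units, primary and semiprimary elements -/

theorem isUnit_iff_norm_eq_one {z : EisensteinRing} : IsUnit z ↔ nrm z = 1 := by
  rw [isUnit_iff_norm_isUnit, Int.isUnit_iff]
  have := norm_nonneg z
  lia

theorem eq_of_isUnit {u : EisensteinRing} (hu : IsUnit u) :
    u = 1 ∨ u = -1 ∨ u = w ∨ u = -w ∨ u = w ^ 2 ∨ u = -w ^ 2 := by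
  have h4 := four_mul_norm u
  rw [isUnit_iff_norm_eq_one.1 hu] at h4
  obtain ⟨a, b⟩ := u
  simp only at h4
  have hb1 : b ≤ 1 := by nlinarith [sq_nonneg (2 * a - b)]
  have hb2 : -1 ≤ b := by nlinarith [sq_nonneg (2 * a - b)]
  have ha1 : a ≤ 1 := by nlinarith [sq_nonneg b]
  have ha2 : -1 ≤ a := by nlinarith [sq_nonneg b]
  interval_cases b <;> interval_cases a <;> first | (exfalso; lia) | decide

theorem norm_isPrimary {z : EisensteinRing} (hz : IsPrimary z) : (3 : ℤ) ∣ nrm z - 1 := by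
  obtain ⟨⟨a, ha⟩, b, hb⟩ := hz
  rw [norm_eq, hb, show z.re = 3 * a + 2 by lia]
  exact ⟨3 * a ^ 2 + 4 * a + 1 - 3 * a * b - 2 * b + 3 * b ^ 2, by ring⟩

theorem IsPrimary.eq_one_of_mul {z u : EisensteinRing} (hz : IsPrimary z) (hzu : IsPrimary (z * u))
    (hu : IsUnit u) : u = 1 := by
  obtain ⟨h1, h2⟩ := hz
  obtain ⟨h3, h4⟩ := hzu
  rw [re_mul] at h3
  rw [im_mul] at h4
  rcases eq_of_isUnit hu with rfl | rfl | rfl | rfl | rfl | rfl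
  · rfl
  all_goals exfalso; simp [w_sq] at h3 h4; lia

/-- Two associated primary elements are equal. -/
theorem IsPrimary.eq_of_associated {z t : EisensteinRing} (hz : IsPrimary z) (ht : IsPrimary t)
    (h : Associated z t) : z = t := by
  obtain ⟨u, rfl⟩ := h
  rw [hz.eq_one_of_mul ht u.isUnit, mul_one]

/-- Among the associates of an element of norm prime to `3` there is a primary one. -/
theorem exists_isPrimary_associated {z : EisensteinRing} (hz : ¬ (3 : ℤ) ∣ nrm z) :
    ∃ t, IsPrimary t ∧ Associated z t := by
  have h : ¬ (3 : ℤ) ∣ z.re + z.im := by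
    rintro ⟨k, hk⟩
    refine hz ⟨3 * k ^ 2 - z.re * z.im, ?_⟩
    rw [norm_eq]
    linear_combination (z.re + z.im + 3 * k) * hk
  suffices ∃ u : EisensteinRing, IsUnit u ∧ IsPrimary (z * u) by
    obtain ⟨_, ⟨u, rfl⟩, hu⟩ := this
    exact ⟨z * u, hu, u, rfl⟩
  have hw : IsUnit w := isUnit_iff_norm_eq_one.2 (by decide)
  have key : IsPrimary (z * 1) ∨ IsPrimary (z * -1) ∨ IsPrimary (z * w) ∨ IsPrimary (z * -w) ∨
      IsPrimary (z * w ^ 2) ∨ IsPrimary (z * -w ^ 2) := by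
    simp only [IsPrimary, re_mul, im_mul, w_sq]
    simp
    lia
  rcases key with h | h | h | h | h | h
  · exact ⟨_, isUnit_one, h⟩
  · exact ⟨_, isUnit_one.neg, h⟩
  · exact ⟨_, hw, h⟩
  · exact ⟨_, hw.neg, h⟩
  · exact ⟨_, hw.pow 2, h⟩
  · exact ⟨_, (hw.pow 2).neg, h⟩

/-- An element congruent to `1` or `2` modulo `3`, that is, primary up to sign. The lower entry of
a cubic Jacobi symbol is of this form. -/
def IsSemiprimary (z : EisensteinRing) : Prop :=
  ¬ (3 : ℤ) ∣ z.re ∧ (3 : ℤ) ∣ z.im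

theorem isSemiprimary_iff {z : EisensteinRing} :
    IsSemiprimary z ↔ IsPrimary z ∨ IsPrimary (-z) := by
  simp only [IsSemiprimary, IsPrimary, re_neg, im_neg]
  lia

theorem IsPrimary.isSemiprimary {z : EisensteinRing} (hz : IsPrimary z) : IsSemiprimary z :=
  isSemiprimary_iff.2 (.inl hz)

theorem IsSemiprimary.neg {z : EisensteinRing} (hz : IsSemiprimary z) : IsSemiprimary (-z) := by
  rw [isSemiprimary_iff] at *
  rwa [neg_neg, or_comm]

theorem isSemiprimary_intCast {n : ℤ} : IsSemiprimary (n : EisensteinRing) ↔ ¬ (3 : ℤ) ∣ n := by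
  simp [IsSemiprimary]

theorem IsSemiprimary.mul {z t : EisensteinRing} (hz : IsSemiprimary z) (ht : IsSemiprimary t) :
    IsSemiprimary (z * t) := by
  obtain ⟨h1, k, hk⟩ := hz
  obtain ⟨h2, l, hl⟩ := ht
  refine ⟨fun h => ?_, ?_⟩
  · rw [re_mul, hk, hl] at h
    have : (3 : ℤ) ∣ z.re * t.re := by
      have h3 : (3 : ℤ) ∣ -1 * (3 * k) * (3 * l) := ⟨-3 * k * l, by ring⟩
      exact (dvd_add_left h3).1 h
    exact (Int.prime_three.dvd_or_dvd this).elim h1 h2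
  · rw [im_mul, hk, hl]
    exact ⟨z.re * l + k * t.re - 3 * k * l, by ring⟩

theorem IsSemiprimary.star {z : EisensteinRing} (hz : IsSemiprimary z) :
    IsSemiprimary (star z) := by
  obtain ⟨h1, h2⟩ := hz
  simp only [IsSemiprimary, re_star, im_star]
  lia

theorem IsPrimary.star {z : EisensteinRing} (hz : IsPrimary z) : IsPrimary (star z) := by
  obtain ⟨h1, h2⟩ := hz
  simp only [IsPrimary, re_star, im_star]
  lia

theorem IsSemiprimary.not_three_dvd_norm {z : EisensteinRing} (hz : IsSemiprimary z) :
    ¬ (3 : ℤ) ∣ nrm z := by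
  rcases isSemiprimary_iff.1 hz with h | h
  · have := norm_isPrimary h
    lia
  · have := norm_isPrimary h
    rw [QuadraticAlgebra.norm_neg] at this
    lia

theorem norm_dvd_norm {z t : EisensteinRing} (h : z ∣ t) : nrm z ∣ nrm t := map_dvd _ h

theorem dvd_norm (z : EisensteinRing) : z ∣ ((nrm z : ℤ) : EisensteinRing) :=
  ⟨star z, (mul_star_eq_norm z).symm⟩

theorem IsSemiprimary.isUnit_of_dvd_three {z : EisensteinRing} (hz : IsSemiprimary z)
    (h : z ∣ 3) : IsUnit z := by
  rw [isUnit_iff_norm_eq_one]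
  have h9 : nrm z ∣ 3 ^ 2 := by
    simpa [norm_eq] using norm_dvd_norm h
  have hpos := norm_nonneg z
  obtain ⟨k, -, hk⟩ := (dvd_prime_pow Int.prime_three 2).1 h9
  rcases Nat.eq_zero_or_pos k with rfl | hk0
  · rw [pow_zero, Int.associated_iff] at hk
    lia
  · exact absurd ((dvd_pow_self 3 hk0.ne').trans hk.symm.dvd) hz.not_three_dvd_norm

theorem IsSemiprimary.not_dvd_three {π : EisensteinRing} (h : IsSemiprimary π) (hp : Prime π) :
    ¬ π ∣ 3 :=
  fun hd => hp.not_isUnit (h.isUnit_of_dvd_three hd)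

theorem one_lt_norm_of_prime {π : EisensteinRing} (hp : Prime π) : 1 < nrm π := by
  have h0 := norm_pos hp.ne_zero
  have h1 := mt isUnit_iff_norm_eq_one.2 hp.not_isUnit
  lia

/-! ### Values of the cubic character -/

/-- The values taken by the cubic residue character: `0` and the cube roots of unity. -/
def IsCubicValue (c : EisensteinRing) : Prop := c = 0 ∨ c = 1 ∨ c = w ∨ c = w ^ 2

theorem isCubicValue_one : IsCubicValue 1 := .inr (.inl rfl)

theorem IsCubicValue.mul {c d : EisensteinRing} (hc : IsCubicValue c) (hd : IsCubicValue d) :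
    IsCubicValue (c * d) := by
  rcases hc with rfl | rfl | rfl | rfl <;> rcases hd with rfl | rfl | rfl | rfl <;>
    simp only [IsCubicValue] <;> decide

theorem IsCubicValue.star {c : EisensteinRing} (hc : IsCubicValue c) : IsCubicValue (star c) := by
  rcases hc with rfl | rfl | rfl | rfl <;> simp only [IsCubicValue] <;> decide

theorem IsCubicValue.cube {c : EisensteinRing} (hc : IsCubicValue c) (h0 : c ≠ 0) : c ^ 3 = 1 := by
  rcases hc with rfl | rfl | rfl | rfl
  · exact absurd rfl h0
  all_goals decide

theorem IsCubicValue.star_eq_sq {c : EisensteinRing} (hc : IsCubicValue c) :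
    Star.star c = c ^ 2 := by
  rcases hc with rfl | rfl | rfl | rfl <;> decide

theorem IsCubicValue.eq_one_of_star_eq {c : EisensteinRing} (hc : IsCubicValue c) (h0 : c ≠ 0)
    (h : Star.star c = c) : c = 1 := by
  have h3 := hc.cube h0
  rw [hc.star_eq_sq] at h
  rwa [pow_succ, h, ← sq, h] at h3

theorem IsCubicValue.sub_dvd_three {c d : EisensteinRing} (hc : IsCubicValue c)
    (hd : IsCubicValue d) (h : c ≠ d) : c - d ∣ 3 := by
  have key : nrm (c - d) = 1 ∨ nrm (c - d) = 3 := by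
    rcases hc with rfl | rfl | rfl | rfl <;> rcases hd with rfl | rfl | rfl | rfl <;>
      first | exact absurd rfl h | decide
  have := dvd_norm (c - d)
  rcases key with h | h <;> rw [h] at this
  · exact this.trans (by simp)
  · simpa using this

/-- The values of the cubic character are pairwise incongruent modulo a semiprimary prime. -/
theorem IsCubicValue.eq_of_dvd_sub {π c d : EisensteinRing} (hp : Prime π) (h : IsSemiprimary π)
    (hc : IsCubicValue c) (hd : IsCubicValue d) (hdvd : π ∣ c - d) : c = d := by
  by_contra hne
  exact h.not_dvd_three hp (hdvd.trans (hc.sub_dvd_three hd hne))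

/-! ### Residue fields and the cubic residue character -/

/-- The residue field of a prime `π`, presented by a surjection `f` from `ℤ[ω]` with kernel `(π)`.
It has `N(π)` elements. -/
theorem exists_residueField {π : EisensteinRing} (hp : Prime π) :
    ∃ (F : Type) (_ : Field F) (_ : Fintype F) (f : EisensteinRing →+* F),
      Function.Surjective f ∧ (∀ z, f z = 0 ↔ π ∣ z) ∧ Fintype.card F = (nrm π).natAbs := by
  have hmax : (Ideal.span {π}).IsMaximal :=
    PrincipalIdealRing.isMaximal_of_irreducible hp.irreducible
  have hcard := card_quotient_span π
  have hfin : Finite (EisensteinRing ⧸ Ideal.span {π}) :=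
    Nat.finite_of_card_ne_zero (by have := norm_pos hp.ne_zero; lia)
  have hft := Fintype.ofFinite (EisensteinRing ⧸ Ideal.span {π})
  refine ⟨EisensteinRing ⧸ Ideal.span {π}, Ideal.Quotient.field _, hft,
    Ideal.Quotient.mk _, Ideal.Quotient.mk_surjective, fun z => ?_, ?_⟩
  · rw [Ideal.Quotient.eq_zero_iff_mem, Ideal.mem_span_singleton]
  · rw [← Nat.card_eq_fintype_card, hcard]

theorem three_mul_div_norm {π : EisensteinRing} (h : IsPrimary π) :
    3 * (((nrm π).natAbs - 1) / 3) = (nrm π).natAbs - 1 := by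
  have := norm_isPrimary h
  have := norm_nonneg π
  lia

theorem dvd_pow_sub_one {π α : EisensteinRing} (hp : Prime π) (hα : ¬ π ∣ α) :
    π ∣ α ^ ((nrm π).natAbs - 1) - 1 := by
  obtain ⟨F, _, _, f, -, hker, hcard⟩ := exists_residueField hp
  rw [← hker, ← hcard, map_sub, map_pow, map_one, sub_eq_zero]
  exact FiniteField.pow_card_sub_one_eq_one _ (mt (hker α).1 hα)

/-- The cubic residue character takes the values `0`, `1`, `ω`, `ω²` and is congruent to
`α ^ ((N(π) - 1) / 3)` modulo `π`. -/
theorem cubicChar_spec {π : EisensteinRing} (hp : Prime π) (h : IsPrimary π) (α : EisensteinRing) :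
    IsCubicValue (cubicChar α π) ∧
      π ∣ α ^ (((nrm π).natAbs - 1) / 3) - cubicChar α π := by
  have h3 := three_mul_div_norm h
  have h1 := one_lt_norm_of_prime hp
  unfold cubicChar
  split_ifs with h0 hone hw hw2
  · rw [sub_zero]
    exact ⟨.inl rfl, h0.trans (dvd_pow_self _ (by lia))⟩
  · exact ⟨.inr (.inl rfl), hone⟩
  · exact ⟨.inr (.inr (.inl rfl)), hw⟩
  · exact ⟨.inr (.inr (.inr rfl)), hw2⟩
  · exfalso
    have := dvd_pow_sub_one hp h0
    rw [← h3, mul_comm, pow_mul] at this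
    have hfac (x : EisensteinRing) : x ^ 3 - 1 = (x - 1) * ((x - w) * (x - w ^ 2)) := by
      linear_combination (x ^ 2 - x) * w_sq_add_w_add_one - (x - 1) * w_cube
    rw [hfac] at this
    rcases hp.dvd_or_dvd this with h | h
    · exact hone h
    · exact (hp.dvd_or_dvd h).elim hw hw2

theorem cubicChar_eq_of_dvd {π α c : EisensteinRing} (hp : Prime π) (h : IsPrimary π)
    (hc : IsCubicValue c) (hdvd : π ∣ α ^ (((nrm π).natAbs - 1) / 3) - c) :
    cubicChar α π = c := by
  obtain ⟨h1, h2⟩ := cubicChar_spec hp h α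
  refine h1.eq_of_dvd_sub hp h.isSemiprimary hc ?_
  have := dvd_sub hdvd h2
  rwa [sub_sub_sub_cancel_left] at this

theorem cubicChar_eq_zero_iff {π : EisensteinRing} (hp : Prime π) (h : IsPrimary π)
    {α : EisensteinRing} : cubicChar α π = 0 ↔ π ∣ α := by
  refine ⟨fun h0 => ?_, fun h => by simp [cubicChar, h]⟩
  have := (cubicChar_spec hp h α).2
  rw [h0, sub_zero] at this
  exact hp.dvd_of_dvd_pow this

theorem cubicChar_mul {π : EisensteinRing} (hp : Prime π) (h : IsPrimary π)
    (α β : EisensteinRing) : cubicChar (α * β) π = cubicChar α π * cubicChar β π := by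
  obtain ⟨h1, h2⟩ := cubicChar_spec hp h α
  obtain ⟨h3, h4⟩ := cubicChar_spec hp h β
  refine cubicChar_eq_of_dvd hp h (h1.mul h3) ?_
  rw [mul_pow]
  have := dvd_add (h2.mul_right (β ^ (((nrm π).natAbs - 1) / 3))) (h4.mul_left (cubicChar α π))
  convert this using 1
  ring

theorem cubicChar_one {π : EisensteinRing} (hp : Prime π) (h : IsPrimary π) :
    cubicChar 1 π = 1 :=
  cubicChar_eq_of_dvd hp h isCubicValue_one (by simp)

theorem cubicChar_congr {π : EisensteinRing} (hp : Prime π) (h : IsPrimary π)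
    {α β : EisensteinRing} (hdvd : π ∣ α - β) : cubicChar α π = cubicChar β π := by
  obtain ⟨h3, h4⟩ := cubicChar_spec hp h β
  refine cubicChar_eq_of_dvd hp h h3 ?_
  have := dvd_add (hdvd.trans (sub_dvd_pow_sub_pow α β (((nrm π).natAbs - 1) / 3))) h4
  rwa [sub_add_sub_cancel] at this

theorem cubicChar_star {π : EisensteinRing} (hp : Prime π) (h : IsPrimary π)
    (α : EisensteinRing) : cubicChar (star α) (star π) = star (cubicChar α π) := by
  obtain ⟨h1, h2⟩ := cubicChar_spec hp h α
  have hp' : Prime (star π) := (MulEquiv.prime_iff (starRingAut (R := EisensteinRing))).2 hp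
  refine cubicChar_eq_of_dvd hp' h.star h1.star ?_
  rw [QuadraticAlgebra.norm_star, ← star_pow, ← star_sub]
  exact map_dvd (starRingAut (R := EisensteinRing)) h2

/-! ### The Jacobi sum of the cubic character -/

section ResidueField

variable {F : Type} [Field F] {f : EisensteinRing →+* F} {π : EisensteinRing}

theorem cubicChar_surjInv (hp : Prime π) (h : IsPrimary π) (hf : Function.Surjective f)
    (hker : ∀ z, f z = 0 ↔ π ∣ z) {x : F} {α : EisensteinRing} (hx : f α = x) :
    cubicChar (Function.surjInv hf x) π = cubicChar α π := by
  refine cubicChar_congr hp h ((hker _).1 ?_)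
  rw [map_sub, Function.surjInv_eq hf, hx, sub_self]

/-- The cubic residue character modulo `π` as a multiplicative character of the residue field
`F = ℤ[ω] / (π)` with values in `ℤ[ω]`. -/
noncomputable def residueChar (hp : Prime π) (h : IsPrimary π) (hf : Function.Surjective f)
    (hker : ∀ z, f z = 0 ↔ π ∣ z) : MulChar F EisensteinRing where
  toFun x := cubicChar (Function.surjInv hf x) π
  map_one' := by
    rw [cubicChar_surjInv hp h hf hker (map_one f), cubicChar_one hp h]
  map_mul' x y := by
    rw [← cubicChar_mul hp h]
    exact cubicChar_surjInv hp h hf hker (by simp [Function.surjInv_eq])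
  map_nonunit' x hx := by
    have hx0 : x = 0 := by simpa using hx
    exact (cubicChar_eq_zero_iff hp h).2 ((hker _).1 (by rw [Function.surjInv_eq hf, hx0]))

variable (hp : Prime π) (h : IsPrimary π) (hf : Function.Surjective f)
  (hker : ∀ z, f z = 0 ↔ π ∣ z)

theorem residueChar_apply (α : EisensteinRing) :
    residueChar hp h hf hker (f α) = cubicChar α π :=
  cubicChar_surjInv hp h hf hker rfl

theorem isCubicValue_residueChar (x : F) : IsCubicValue (residueChar hp h hf hker x) := by
  obtain ⟨α, rfl⟩ := hf x
  rw [residueChar_apply]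
  exact (cubicChar_spec hp h α).1

theorem map_residueChar (x : F) :
    f (residueChar hp h hf hker x) = x ^ (((nrm π).natAbs - 1) / 3) := by
  obtain ⟨α, rfl⟩ := hf x
  rw [residueChar_apply, ← map_pow]
  have := (hker _).2 (cubicChar_spec hp h α).2
  rw [map_sub, sub_eq_zero] at this
  exact this.symm

theorem residueChar_pow_three : residueChar hp h hf hker ^ 3 = 1 := by
  refine MulChar.ext fun x => ?_
  rw [MulChar.pow_apply_coe, MulChar.one_apply_coe]
  exact (isCubicValue_residueChar hp h hf hker _).cube
    ((x.isUnit.map (residueChar hp h hf hker)).ne_zero)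

theorem residueChar_neg_one : residueChar hp h hf hker (-1) = 1 := by
  have h3 := congrArg (· (-1)) (residueChar_pow_three hp h hf hker)
  simp only [MulChar.pow_apply' _ three_ne_zero, ← map_pow] at h3
  rwa [show (-1 : F) ^ 3 = -1 by ring, MulChar.one_apply (isUnit_one.neg)] at h3

theorem star_residueChar (x : F) :
    star (residueChar hp h hf hker x) = (residueChar hp h hf hker)⁻¹ x := by
  have h3 : (residueChar hp h hf hker)⁻¹ = residueChar hp h hf hker ^ 2 := by
    rw [inv_eq_iff_mul_eq_one, ← pow_succ', residueChar_pow_three]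
  rw [h3, MulChar.pow_apply' _ two_ne_zero]
  exact (isCubicValue_residueChar hp h hf hker x).star_eq_sq

variable [Fintype F]

/-- A generator of the cyclic group `Fˣ` has nontrivial cubic character. -/
theorem residueChar_ne_one (hcard : Fintype.card F = (nrm π).natAbs) :
    residueChar hp h hf hker ≠ 1 := by
  classical
  intro hone
  obtain ⟨g, hg⟩ := IsCyclic.exists_generator (α := Fˣ)
  have ho : orderOf g = (nrm π).natAbs - 1 := by
    rw [orderOf_eq_card_of_forall_mem_zpowers hg, Nat.card_eq_fintype_card, Fintype.card_units,
      hcard]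
  have h1 := map_residueChar hp h hf hker (g : F)
  rw [hone, MulChar.one_apply_coe, map_one] at h1
  have h2 : g ^ (((nrm π).natAbs - 1) / 3) = 1 := by
    ext
    push_cast
    exact h1.symm
  have h3 := orderOf_dvd_of_pow_eq_one h2
  have h4 := three_mul_div_norm h
  have h5 := one_lt_norm_of_prime hp
  have := Nat.le_of_dvd (by lia) h3
  lia

theorem residueChar_sq_ne_one (hcard : Fintype.card F = (nrm π).natAbs) :
    residueChar hp h hf hker * residueChar hp h hf hker ≠ 1 := by
  intro hone
  refine residueChar_ne_one hp h hf hker hcard ?_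
  have := residueChar_pow_three hp h hf hker
  rwa [pow_succ, sq, hone, one_mul] at this

/-- A polynomial of degree less than `#F - 1` sums to zero over the finite field `F`. -/
theorem sum_eval_eq_zero (p : Polynomial F) (hdeg : p.natDegree < Fintype.card F - 1) :
    ∑ x : F, p.eval x = 0 := by
  simp_rw [Polynomial.eval_eq_sum_range]
  rw [Finset.sum_comm]
  refine Finset.sum_eq_zero fun i hi => ?_
  rw [← Finset.mul_sum, FiniteField.sum_pow_lt_card_sub_one, mul_zero]
  have := Finset.mem_range.1 hi
  lia

/-- Modulo `π` the Jacobi sum is the sum over `F` of a polynomial of degree `2(N(π) - 1) / 3`. -/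
theorem dvd_jacobiSum (hcard : Fintype.card F = (nrm π).natAbs) :
    π ∣ jacobiSum (residueChar hp h hf hker) (residueChar hp h hf hker) := by
  rw [← hker, jacobiSum, map_sum]
  simp_rw [map_mul, map_residueChar]
  have h4 := three_mul_div_norm h
  have h5 := one_lt_norm_of_prime hp
  set k := ((nrm π).natAbs - 1) / 3
  have := sum_eval_eq_zero (F := F) (Polynomial.X ^ k * (1 - Polynomial.X) ^ k) ?_
  · simpa using this
  · have h1 : (1 - Polynomial.X : Polynomial F).natDegree ≤ 1 := by
      compute_degree
    have h2 := Polynomial.natDegree_mul_le (p := (Polynomial.X : Polynomial F) ^ k)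
      (q := (1 - Polynomial.X) ^ k)
    have h3 := Polynomial.natDegree_pow_le_of_le k h1
    rw [Polynomial.natDegree_X_pow] at h2
    lia

theorem isPrimitiveRoot_w : IsPrimitiveRoot w 3 :=
  IsPrimitiveRoot.mk_of_lt w (by norm_num) w_cube fun l h0 h3 => by
    interval_cases l <;> decide

theorem isPrimary_jacobiSum (hcard : Fintype.card F = (nrm π).natAbs) :
    IsPrimary (jacobiSum (residueChar hp h hf hker) (residueChar hp h hf hker)) := by
  have h4 := three_mul_div_norm h
  obtain ⟨z, -, hz⟩ := exists_jacobiSum_eq_neg_one_add (n := 3) (by norm_num)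
    (residueChar_pow_three hp h hf hker) (residueChar_pow_three hp h hf hker)
    (by rw [hcard, ← h4]; exact dvd_mul_right _ _) isPrimitiveRoot_w
  rw [hz, show (w - 1) ^ 2 = 3 * -w by decide, mul_left_comm]
  constructor
  · exact ⟨(z * -w).re - 1, by rw [re_add, re_mul 3]; simp; ring⟩
  · exact ⟨(z * -w).im, by rw [im_add, im_mul 3]; simp⟩

theorem jacobiSum_mul_star (hcard : Fintype.card F = (nrm π).natAbs) :
    jacobiSum (residueChar hp h hf hker) (residueChar hp h hf hker) *
      star (jacobiSum (residueChar hp h hf hker) (residueChar hp h hf hker)) =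
      Fintype.card F := by
  set χ := residueChar hp h hf hker with hχ
  have hstar : star (jacobiSum χ χ) = jacobiSum χ⁻¹ χ⁻¹ := by
    rw [jacobiSum, star_sum]
    simp_rw [star_mul', hχ, star_residueChar]
    rfl
  rw [hstar]
  -- the identity is available for characters with values in a field
  have hinj := IsFractionRing.injective EisensteinRing (FractionRing EisensteinRing)
  apply hinj
  have : CharZero (FractionRing EisensteinRing) := charZero_of_injective_algebraMap hinj
  rw [map_mul, ← jacobiSum_ringHomComp, ← jacobiSum_ringHomComp, ← MulChar.ringHomComp_inv,
    map_natCast]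
  have hne := (MulChar.ringHomComp_ne_one_iff hinj).2 (residueChar_ne_one hp h hf hker hcard)
  refine jacobiSum_mul_jacobiSum_inv ?_ hne hne ?_
  · rw [ringChar.eq_zero]
    exact (CharP.ringChar_ne_zero_of_finite F).symm
  · rw [← MulChar.ringHomComp_mul]
    exact (MulChar.ringHomComp_ne_one_iff hinj).2 (residueChar_sq_ne_one hp h hf hker hcard)

/-- The Jacobi sum of the cubic residue character modulo a primary prime `π` is `π` itself: it is
primary, divisible by `π`, and has the same norm as `π`. -/
theorem jacobiSum_residueChar (hcard : Fintype.card F = (nrm π).natAbs) :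
    jacobiSum (residueChar hp h hf hker) (residueChar hp h hf hker) = π := by
  have hprim := isPrimary_jacobiSum hp h hf hker hcard
  have hJ := jacobiSum_mul_star hp h hf hker hcard
  obtain ⟨t, ht⟩ := dvd_jacobiSum hp h hf hker hcard
  rw [mul_star_eq_norm, hcard] at hJ
  have hn : nrm π * nrm t = nrm π := by
    rw [← map_mul, ← ht]
    have h1 : nrm (jacobiSum (residueChar hp h hf hker) (residueChar hp h hf hker)) =
        ((nrm π).natAbs : ℤ) := by
      simpa using congrArg QuadraticAlgebra.re hJ
    rw [h1, Int.natAbs_of_nonneg (norm_nonneg π)]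
  have ht1 : nrm t = 1 := by
    have := norm_pos hp.ne_zero
    exact mul_left_cancel₀ this.ne' (by rw [hn, mul_one])
  rw [ht] at hprim ⊢
  rw [h.eq_one_of_mul hprim (isUnit_iff_norm_eq_one.2 ht1), mul_one]

end ResidueField

/-! ### Gauss sums and the reciprocity law for primes -/

theorem gaussSum_frob_iterate {R R' : Type*} [CommRing R] [Fintype R] [CommRing R'] (p : ℕ)
    [Fact p.Prime] [CharP R' p] (χ : MulChar R R') (ψ : AddChar R R') (n : ℕ) :
    gaussSum χ ψ ^ p ^ n = gaussSum (χ ^ p ^ n) (ψ ^ p ^ n) := by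
  induction n with
  | zero => simp
  | succ n ih => rw [pow_succ, pow_mul, ih, gaussSum_frob, ← pow_mul, ← pow_mul]

/-- The Gauss sum `g` of the cubic residue character of `π`, formed over an extension of the
residue field of `l`, satisfies `g ^ 3 = N(π) π`, and raising it to the power `N(l)` multiplies it
by `χ_π(N(l))⁻¹`. Comparing the two gives `χ_l(N(π) π) χ_π(N(l)) = 1`. -/
theorem cubicChar_norm_mul_cubicChar {π l : EisensteinRing} (hp : Prime π) (h : IsPrimary π)
    (hl : Prime l) (h' : IsPrimary l) (hcop : IsCoprime (nrm π) (nrm l)) :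
    cubicChar ((nrm l : ℤ) : EisensteinRing) π *
      cubicChar (((nrm π : ℤ) : EisensteinRing) * π) l = 1 := by
  obtain ⟨F, _, _, f, hf, hker, hcard⟩ := exists_residueField hp
  obtain ⟨F', _, _, f', hf', hker', hcard'⟩ := exists_residueField hl
  obtain ⟨n, hq, hc⟩ := FiniteField.card F (ringChar F)
  obtain ⟨n', hq', hc'⟩ := FiniteField.card F' (ringChar F')
  have hnat : (nrm π).natAbs.Coprime (nrm l).natAbs := Int.isCoprime_iff_gcd_eq_one.1 hcop
  have hch : ringChar F' ≠ ringChar F := by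
    intro he
    rw [← hcard, ← hcard', hc, hc', he] at hnat
    have := Nat.Coprime.coprime_dvd_left (dvd_pow_self _ n.ne_zero)
      (Nat.Coprime.coprime_dvd_right (dvd_pow_self _ n'.ne_zero) hnat)
    rw [Nat.coprime_self] at this
    exact hq.ne_one this
  let ψ := AddChar.FiniteField.primitiveChar F F' hch
  let K := CyclotomicField ψ.n F'
  have hchar := Algebra.ringChar_eq F' K
  have : Fact (ringChar F').Prime := ⟨hq'⟩
  have : CharP K (ringChar F') := hchar ▸ ringChar.charP K
  let i : EisensteinRing →+* K := (algebraMap F' K).comp f'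
  have hi (z : EisensteinRing) : i z = 0 ↔ l ∣ z := by
    rw [← hker']
    exact map_eq_zero_iff _ (algebraMap F' K).injective
  set χ := residueChar hp h hf hker with hχ
  have hχ3 : χ.ringHomComp i ^ 3 = 1 := by
    rw [MulChar.ringHomComp_pow, hχ, residueChar_pow_three, MulChar.ringHomComp_one]
  have hM3 := three_mul_div_norm h'
  have hM1 := one_lt_norm_of_prime hl
  set M := (nrm l).natAbs with hM
  -- the character with values in `K` is still nontrivial, as `l` does not divide `3`
  have hχ1 : χ.ringHomComp i ≠ 1 := by
    intro hone
    refine residueChar_ne_one hp h hf hker hcard (MulChar.ext fun x => ?_)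
    rw [MulChar.one_apply_coe]
    refine (isCubicValue_residueChar hp h hf hker x).eq_of_dvd_sub hl h'.isSemiprimary
      isCubicValue_one ((hi _).1 ?_)
    have := congrArg (fun φ => φ (x : F)) hone
    simp only [MulChar.ringHomComp_apply, MulChar.one_apply_coe] at this
    rw [map_sub, map_one, sub_eq_zero]
    exact this
  have hord : orderOf (χ.ringHomComp i) = 3 := orderOf_eq_prime hχ3 hχ1
  have hg3 : gaussSum (χ.ringHomComp i) ψ.char ^ 3 = i (((nrm π : ℤ) : EisensteinRing) * π) := by
    have := gaussSum_pow_eq_prod_jacobiSum (χ := χ.ringHomComp i) (by rw [hord]; norm_num) ψ.prim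
    rw [hord, show Finset.Ico 1 (3 - 1) = {1} by decide, Finset.prod_singleton, pow_one,
      jacobiSum_ringHomComp, hχ, jacobiSum_residueChar hp h hf hker hcard,
      MulChar.ringHomComp_apply, residueChar_neg_one, map_one, one_mul, hcard] at this
    rw [this, map_mul, map_intCast]
    congr 1
    rw [← Int.cast_natCast, Int.natAbs_of_nonneg (norm_nonneg π)]
  have hMF : IsUnit (M : F) := by
    rw [isUnit_iff_ne_zero, Ne, ringChar.spec]
    intro hd
    rw [← hcard, hc] at hnat
    exact hq.ne_one (Nat.dvd_one.1 (hnat ▸ Nat.dvd_gcd (dvd_pow_self _ n.ne_zero) hd))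
  have hgM : i (χ (M : F)) * gaussSum (χ.ringHomComp i) ψ.char ^ M =
      gaussSum (χ.ringHomComp i) ψ.char := by
    have h1 := gaussSum_frob_iterate (ringChar F') (χ.ringHomComp i) ψ.char n'
    rw [← hc', hcard'] at h1
    have h2 : χ.ringHomComp i ^ M = χ.ringHomComp i := by
      have h3 : M = 3 * ((M - 1) / 3) + 1 := by lia
      rw [h3, pow_succ, pow_mul, hχ3, one_pow, one_mul]
    rw [h1, h2, AddChar.pow_mulShift]
    exact gaussSum_mulShift (χ.ringHomComp i) ψ.char hMF.unit
  have hg0 : gaussSum (χ.ringHomComp i) ψ.char ≠ 0 := by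
    refine gaussSum_ne_zero_of_nontrivial ?_ hχ1 ψ.prim
    rw [Ne, ringChar.spec, ← hchar, hcard]
    intro hd
    rw [← hcard', hc'] at hnat
    exact hq'.ne_one (Nat.dvd_one.1 (hnat ▸ Nat.dvd_gcd hd (dvd_pow_self _ n'.ne_zero)))
  have key : i (χ (M : F) * cubicChar (((nrm π : ℤ) : EisensteinRing) * π) l) = 1 := by
    have h1 := (hi _).2 (cubicChar_spec hl h' (((nrm π : ℤ) : EisensteinRing) * π)).2
    rw [map_sub, sub_eq_zero] at h1
    rw [map_mul, ← h1, map_pow, ← hg3, ← pow_mul, ← hM, hM3]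
    apply mul_right_cancel₀ hg0
    rw [mul_assoc, ← pow_succ, Nat.sub_add_cancel (by lia), hgM, one_mul]
  have hχM : χ (M : F) = cubicChar ((nrm l : ℤ) : EisensteinRing) π := by
    rw [← residueChar_apply hp h hf hker, map_intCast, ← Int.cast_natCast, hM,
      Int.natAbs_of_nonneg (norm_nonneg l)]
  rw [← hχM]
  refine ((isCubicValue_residueChar hp h hf hker _).mul
    (cubicChar_spec hl h' _).1).eq_of_dvd_sub hl h'.isSemiprimary isCubicValue_one ((hi _).1 ?_)
  rw [map_sub, key, map_one, sub_self]

/-! ### Factorization into primary primes -/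

theorem isSemiprimary_multiset_prod {s : Multiset EisensteinRing}
    (hs : ∀ π ∈ s, IsSemiprimary π) : IsSemiprimary s.prod := by
  induction s using Multiset.induction_on with
  | empty => exact ⟨by simp, by simp⟩
  | cons π s ih =>
    rw [Multiset.prod_cons]
    exact (hs π (Multiset.mem_cons_self _ _)).mul
      (ih fun l hl => hs l (Multiset.mem_cons_of_mem hl))

theorem IsPrimaryFactorization.isSemiprimary {β : EisensteinRing} {s : Multiset EisensteinRing}
    (hs : IsPrimaryFactorization β s) : IsSemiprimary β := by
  have := isSemiprimary_multiset_prod fun π hπ => (hs.1 π hπ).2.isSemiprimary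
  rcases hs.2 with h | h
  · rwa [h]
  · rw [h]
    exact this.neg

theorem IsPrimaryFactorization.associated {β : EisensteinRing} {s : Multiset EisensteinRing}
    (hs : IsPrimaryFactorization β s) : Associated β s.prod := by
  rcases hs.2 with h | h
  · rw [h]
  · rw [h]
    exact (Associated.refl _).neg_left

theorem exists_primary_primes_associated (z : EisensteinRing) (hz : ¬ (3 : ℤ) ∣ nrm z) :
    ∃ s : Multiset EisensteinRing, (∀ π ∈ s, Prime π ∧ IsPrimary π) ∧ Associated z s.prod := by
  induction z using UniqueFactorizationMonoid.induction_on_prime with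
  | h₁ => exact absurd (by simp) hz
  | h₂ u hu =>
    exact ⟨0, by simp, by simpa [associated_one_iff_isUnit] using hu⟩
  | h₃ a p ha hp ih =>
    rw [map_mul] at hz
    obtain ⟨s, hs, has⟩ := ih fun h => hz (h.mul_left _)
    obtain ⟨t, ht, hpt⟩ := exists_isPrimary_associated fun h => hz (h.mul_right _)
    refine ⟨t ::ₘ s, fun π hπ => ?_, ?_⟩
    · rcases Multiset.mem_cons.1 hπ with rfl | h
      · exact ⟨hpt.prime hp, ht⟩
      · exact hs π h
    · rw [Multiset.prod_cons]
      exact hpt.mul_mul has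

theorem IsSemiprimary.exists_isPrimaryFactorization {β : EisensteinRing} (hβ : IsSemiprimary β) :
    ∃ s, IsPrimaryFactorization β s := by
  obtain ⟨s, hs, u, hu⟩ := exists_primary_primes_associated β hβ.not_three_dvd_norm
  refine ⟨s, hs, ?_⟩
  have hsp := isSemiprimary_multiset_prod fun π hπ => (hs π hπ).2.isSemiprimary
  rw [← hu] at hsp ⊢
  -- the unit relating `β` to a product of primary primes is `± 1`
  have key : (u : EisensteinRing) = 1 ∨ (-u : EisensteinRing) = 1 := by
    rcases isSemiprimary_iff.1 hβ with h1 | h1 <;> rcases isSemiprimary_iff.1 hsp with h2 | h2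
    · exact .inl (h1.eq_one_of_mul h2 u.isUnit)
    · exact .inr (h1.eq_one_of_mul (by rwa [mul_neg]) u.isUnit.neg)
    · exact .inr (h1.eq_one_of_mul (by rwa [neg_mul_neg]) u.isUnit.neg)
    · exact .inl (h1.eq_one_of_mul (by rwa [neg_mul]) u.isUnit)
  rcases key with h | h
  · left; rw [h, mul_one]
  · right; rw [← mul_neg, h, mul_one]

theorem IsPrimaryFactorization.unique {β : EisensteinRing} {s t : Multiset EisensteinRing}
    (hs : IsPrimaryFactorization β s) (ht : IsPrimaryFactorization β t) : s = t := by
  have := UniqueFactorizationMonoid.factors_unique (fun π hπ => (hs.1 π hπ).1.irreducible)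
    (fun π hπ => (ht.1 π hπ).1.irreducible) (hs.associated.symm.trans ht.associated)
  exact Multiset.rel_eq.1 (this.mono fun a ha b hb hab =>
    (hs.1 a ha).2.eq_of_associated (ht.1 b hb).2 hab)

theorem IsPrimaryFactorization.mul {β γ : EisensteinRing} {s t : Multiset EisensteinRing}
    (hs : IsPrimaryFactorization β s) (ht : IsPrimaryFactorization γ t) :
    IsPrimaryFactorization (β * γ) (s + t) := by
  refine ⟨fun π hπ => (Multiset.mem_add.1 hπ).elim (hs.1 π) (ht.1 π), ?_⟩
  rw [Multiset.prod_add]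
  rcases hs.2 with h1 | h1 <;> rcases ht.2 with h2 | h2 <;> rw [h1, h2] <;> simp

theorem prime_star {π : EisensteinRing} (hp : Prime π) : Prime (star π) :=
  (MulEquiv.prime_iff (starRingAut (R := EisensteinRing))).2 hp

theorem IsPrimaryFactorization.star {β : EisensteinRing} {s : Multiset EisensteinRing}
    (hs : IsPrimaryFactorization β s) :
    IsPrimaryFactorization (star β) (s.map Star.star) := by
  have hprod : (s.map Star.star).prod = Star.star s.prod :=
    (map_multiset_prod (starRingAut (R := EisensteinRing)) s).symm
  refine ⟨fun π hπ => ?_, ?_⟩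
  · obtain ⟨l, hl, rfl⟩ := Multiset.mem_map.1 hπ
    exact ⟨prime_star (hs.1 l hl).1, (hs.1 l hl).2.star⟩
  · rw [hprod]
    rcases hs.2 with h | h <;> rw [h] <;> simp

theorem IsPrimary.isPrimaryFactorization {π : EisensteinRing} (h : IsPrimary π) (hp : Prime π) :
    IsPrimaryFactorization π {π} :=
  ⟨fun l hl => by rw [Multiset.mem_singleton.1 hl]; exact ⟨hp, h⟩, .inl (by simp)⟩

/-! ### The cubic Jacobi symbol -/

theorem IsPrimaryFactorization.cubicJacobi_eq {β : EisensteinRing} {s : Multiset EisensteinRing}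
    (hs : IsPrimaryFactorization β s) (α : EisensteinRing) :
    cubicJacobi α β = (s.map (cubicChar α)).prod := by
  have h : ∃ s, IsPrimaryFactorization β s := ⟨s, hs⟩
  rw [cubicJacobi, dif_pos h, h.choose_spec.unique hs]

theorem cubicJacobi_prime {π : EisensteinRing} (hp : Prime π) (h : IsPrimary π)
    (α : EisensteinRing) : cubicJacobi α π = cubicChar α π := by
  rw [(h.isPrimaryFactorization hp).cubicJacobi_eq]
  simp

variable {α α' β γ : EisensteinRing}

theorem cubicJacobi_mul_right (hβ : IsSemiprimary β) (hγ : IsSemiprimary γ)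
    (α : EisensteinRing) : cubicJacobi α (β * γ) = cubicJacobi α β * cubicJacobi α γ := by
  obtain ⟨s, hs⟩ := hβ.exists_isPrimaryFactorization
  obtain ⟨t, ht⟩ := hγ.exists_isPrimaryFactorization
  rw [hs.cubicJacobi_eq, ht.cubicJacobi_eq, (hs.mul ht).cubicJacobi_eq, Multiset.map_add,
    Multiset.prod_add]

theorem cubicJacobi_mul_left (hβ : IsSemiprimary β) (α α' : EisensteinRing) :
    cubicJacobi (α * α') β = cubicJacobi α β * cubicJacobi α' β := by
  obtain ⟨s, hs⟩ := hβ.exists_isPrimaryFactorization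
  rw [hs.cubicJacobi_eq, hs.cubicJacobi_eq, hs.cubicJacobi_eq, ← Multiset.prod_map_mul]
  exact congrArg _ (Multiset.map_congr rfl fun π hπ =>
    cubicChar_mul (hs.1 π hπ).1 (hs.1 π hπ).2 _ _)

theorem cubicJacobi_one_left (hβ : IsSemiprimary β) : cubicJacobi 1 β = 1 := by
  obtain ⟨s, hs⟩ := hβ.exists_isPrimaryFactorization
  rw [hs.cubicJacobi_eq, Multiset.prod_eq_one]
  intro c hc
  obtain ⟨π, hπ, rfl⟩ := Multiset.mem_map.1 hc
  exact cubicChar_one (hs.1 π hπ).1 (hs.1 π hπ).2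

theorem cubicJacobi_pow_left (hβ : IsSemiprimary β) (α : EisensteinRing) (n : ℕ) :
    cubicJacobi (α ^ n) β = cubicJacobi α β ^ n := by
  induction n with
  | zero => simp [cubicJacobi_one_left hβ]
  | succ n ih => rw [pow_succ, cubicJacobi_mul_left hβ, ih, pow_succ]

theorem cubicJacobi_of_isUnit (hβ : IsSemiprimary β) (hu : IsUnit β) (α : EisensteinRing) :
    cubicJacobi α β = 1 := by
  obtain ⟨s, hs⟩ := hβ.exists_isPrimaryFactorization
  have h0 : s = 0 := by
    refine Multiset.eq_zero_of_forall_notMem fun π hπ => (hs.1 π hπ).1.not_isUnit ?_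
    exact isUnit_of_dvd_unit (Multiset.dvd_prod hπ) (hs.associated.isUnit hu)
  rw [hs.cubicJacobi_eq, h0, Multiset.map_zero, Multiset.prod_zero]

theorem IsPrimaryFactorization.dvd {s : Multiset EisensteinRing} (hs : IsPrimaryFactorization β s)
    {π : EisensteinRing} (hπ : π ∈ s) : π ∣ β :=
  (Multiset.dvd_prod hπ).trans hs.associated.symm.dvd

theorem cubicJacobi_congr (hβ : IsSemiprimary β) (h : β ∣ α - α') :
    cubicJacobi α β = cubicJacobi α' β := by
  obtain ⟨s, hs⟩ := hβ.exists_isPrimaryFactorization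
  rw [hs.cubicJacobi_eq, hs.cubicJacobi_eq]
  exact congrArg _ (Multiset.map_congr rfl fun π hπ =>
    cubicChar_congr (hs.1 π hπ).1 (hs.1 π hπ).2 ((hs.dvd hπ).trans h))

theorem isCubicValue_cubicJacobi (hβ : IsSemiprimary β) (α : EisensteinRing) :
    IsCubicValue (cubicJacobi α β) := by
  obtain ⟨s, hs⟩ := hβ.exists_isPrimaryFactorization
  rw [hs.cubicJacobi_eq]
  refine Multiset.prod_induction IsCubicValue _ (fun _ _ => IsCubicValue.mul) isCubicValue_one
    fun c hc => ?_
  obtain ⟨π, hπ, rfl⟩ := Multiset.mem_map.1 hc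
  exact (cubicChar_spec (hs.1 π hπ).1 (hs.1 π hπ).2 α).1

theorem cubicJacobi_ne_zero (hβ : IsSemiprimary β) (h : IsCoprime α β) : cubicJacobi α β ≠ 0 := by
  obtain ⟨s, hs⟩ := hβ.exists_isPrimaryFactorization
  rw [hs.cubicJacobi_eq]
  refine Multiset.prod_ne_zero fun h0 => ?_
  obtain ⟨π, hπ, h1⟩ := Multiset.mem_map.1 h0
  rw [cubicChar_eq_zero_iff (hs.1 π hπ).1 (hs.1 π hπ).2] at h1
  exact (hs.1 π hπ).1.not_isUnit (h.isUnit_of_dvd' h1 (hs.dvd hπ))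

theorem cubicJacobi_cube (hβ : IsSemiprimary β) (h : cubicJacobi α β ≠ 0) :
    cubicJacobi (α ^ 3) β = 1 := by
  rw [cubicJacobi_pow_left hβ]
  exact (isCubicValue_cubicJacobi hβ α).cube h

theorem cubicJacobi_neg_left (hβ : IsSemiprimary β) (α : EisensteinRing) :
    cubicJacobi (-α) β = cubicJacobi α β := by
  have h1 : cubicJacobi (-1) β = 1 := by
    rw [show (-1 : EisensteinRing) = (-1) ^ 3 by ring]
    exact cubicJacobi_cube hβ (cubicJacobi_ne_zero hβ isCoprime_one_left.neg_left)
  rw [← neg_one_mul, cubicJacobi_mul_left hβ, h1, one_mul]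

theorem cubicJacobi_star (hβ : IsSemiprimary β) (α : EisensteinRing) :
    cubicJacobi (star α) (star β) = star (cubicJacobi α β) := by
  obtain ⟨s, hs⟩ := hβ.exists_isPrimaryFactorization
  rw [hs.cubicJacobi_eq, hs.star.cubicJacobi_eq, Multiset.map_map]
  refine Eq.trans ?_ (map_multiset_prod (starRingAut (R := EisensteinRing)) _).symm
  rw [Multiset.map_map]
  exact congrArg _ (Multiset.map_congr rfl fun π hπ =>
    cubicChar_star (hs.1 π hπ).1 (hs.1 π hπ).2 α)

/-- Over a rational integer the symbol of a real or purely imaginary element is trivial: it is a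
cube root of unity fixed by conjugation. -/
theorem cubicJacobi_intCast_right_eq_one {n : ℤ} (hn : ¬ (3 : ℤ) ∣ n)
    (hα : star α = α ∨ star α = -α) (h : IsCoprime α n) : cubicJacobi α n = 1 := by
  have hn' := isSemiprimary_intCast.2 hn
  refine (isCubicValue_cubicJacobi hn' α).eq_one_of_star_eq (cubicJacobi_ne_zero hn' h) ?_
  rw [← cubicJacobi_star hn', star_intCast]
  rcases hα with h | h <;> rw [h]
  exact cubicJacobi_neg_left hn' α

theorem cubicJacobi_intCast_intCast {m n : ℤ} (hn : ¬ (3 : ℤ) ∣ n)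
    (h : IsCoprime (m : EisensteinRing) n) : cubicJacobi m n = 1 :=
  cubicJacobi_intCast_right_eq_one hn (.inl (star_intCast m)) h

/-! ### Reciprocity with a rational integer -/

theorem isCoprime_intCast_iff {m n : ℤ} :
    IsCoprime (m : EisensteinRing) n ↔ IsCoprime m n := by
  refine ⟨fun ⟨a, b, h⟩ => ⟨a.re, b.re, ?_⟩, fun h => h.map (Int.castRingHom EisensteinRing)⟩
  simpa [re_mul] using congrArg QuadraticAlgebra.re h

theorem isCoprime_star_intCast {n : ℤ} (h : IsCoprime α (n : EisensteinRing)) :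
    IsCoprime (star α) (n : EisensteinRing) := by
  have := h.map (starRingAut (R := EisensteinRing)).toRingHom
  simpa [star_intCast] using this

theorem isCoprime_norm_intCast {n : ℤ} (h : IsCoprime α (n : EisensteinRing)) :
    IsCoprime (nrm α) n := by
  rw [← isCoprime_intCast_iff, ← mul_star_eq_norm]
  exact h.mul_left (isCoprime_star_intCast h)

/-- Reciprocity between a primary prime `π` and a rational integer `n`: the relation
`χ_l(N(π) π) χ_π(N(l)) = 1` is multiplied over the primary primes `l` dividing `n`, whose norms have
product `n ^ 2`. -/
theorem cubicJacobi_intCast_right_of_prime {π : EisensteinRing} (hp : Prime π) (h : IsPrimary π)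
    {n : ℤ} (hn : ¬ (3 : ℤ) ∣ n) (hcop : IsCoprime π (n : EisensteinRing)) :
    cubicJacobi π n = cubicJacobi n π := by
  have hn' := isSemiprimary_intCast.2 hn
  obtain ⟨s, hs⟩ := hn'.exists_isPrimaryFactorization
  have hNn := isCoprime_norm_intCast hcop
  have hN1 : cubicJacobi ((nrm π : ℤ) : EisensteinRing) n = 1 :=
    cubicJacobi_intCast_intCast hn (isCoprime_intCast_iff.2 hNn)
  have key : cubicChar ((n : EisensteinRing) ^ 2) π *
      cubicJacobi (((nrm π : ℤ) : EisensteinRing) * π) n = 1 := by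
    have h1 : (n : EisensteinRing) ^ 2 =
        (s.map fun l => ((nrm l : ℤ) : EisensteinRing)).prod := by
      have h0 : nrm (n : EisensteinRing) = n ^ 2 := by simp
      have h2 : nrm s.prod = n ^ 2 := by
        rw [← h0]
        rcases hs.2 with h | h <;> rw [h]
        rw [QuadraticAlgebra.norm_neg]
      rw [← Int.cast_pow, ← h2, map_multiset_prod]
      refine (map_multiset_prod (Int.castRingHom EisensteinRing) _).trans ?_
      rw [Multiset.map_map]
      rfl
    have h2 (t : Multiset EisensteinRing) :
        cubicChar (t.prod) π = (t.map fun l => cubicChar l π).prod := by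
      induction t using Multiset.induction_on with
      | empty => simp [cubicChar_one hp h]
      | cons a t ih => simp [cubicChar_mul hp h, ih]
    rw [h1, h2, hs.cubicJacobi_eq, Multiset.map_map, ← Multiset.prod_map_mul]
    refine Multiset.prod_eq_one fun c hc => ?_
    obtain ⟨l, hl, rfl⟩ := Multiset.mem_map.1 hc
    refine cubicChar_norm_mul_cubicChar hp h (hs.1 l hl).1 (hs.1 l hl).2 ?_
    have hd : nrm l ∣ n ^ 2 := by
      simpa using norm_dvd_norm (hs.dvd hl)
    exact (hNn.pow_right (n := 2)).of_isCoprime_of_dvd_right hd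
  rw [cubicJacobi_mul_left hn', hN1, one_mul, sq, cubicChar_mul hp h] at key
  rw [cubicJacobi_prime hp h]
  have hc := (cubicChar_spec hp h (n : EisensteinRing)).1
  have h3 := hc.cube fun h0 => by rw [h0] at key; simp at key
  linear_combination (cubicChar (n : EisensteinRing) π) * key - cubicJacobi π n * h3

/-- The cubic reciprocity law between a semiprimary element and a rational integer. -/
theorem cubicJacobi_intCast_right (hβ : IsSemiprimary β) {n : ℤ} (hn : ¬ (3 : ℤ) ∣ n)
    (hcop : IsCoprime β (n : EisensteinRing)) : cubicJacobi β n = cubicJacobi n β := by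
  have hn' := isSemiprimary_intCast.2 hn
  obtain ⟨s, hs⟩ := hβ.exists_isPrimaryFactorization
  have h1 : cubicJacobi β n = cubicJacobi s.prod n := by
    rcases hs.2 with h | h <;> rw [h]
    exact cubicJacobi_neg_left hn' _
  have h2 (t : Multiset EisensteinRing) :
      cubicJacobi t.prod n = (t.map fun l => cubicJacobi l n).prod := by
    induction t using Multiset.induction_on with
    | empty => simp [cubicJacobi_one_left hn']
    | cons a t ih => simp [cubicJacobi_mul_left hn', ih]
  rw [h1, h2, hs.cubicJacobi_eq]
  refine congrArg _ (Multiset.map_congr rfl fun π hπ => ?_)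
  obtain ⟨hp, h⟩ := hs.1 π hπ
  rw [← cubicJacobi_prime hp h]
  exact cubicJacobi_intCast_right_of_prime hp h hn (hcop.of_isCoprime_of_dvd_left (hs.dvd hπ))

/-! ### The symbol of `√-3` -/

/-- The square root `1 + 2ω` of `-3`. -/
def theta : EisensteinRing := 1 + 2 * w

theorem theta_sq : theta ^ 2 = -3 := by decide

theorem star_theta : star theta = -theta := by decide

theorem theta_dvd_three : theta ∣ 3 := ⟨-theta, by linear_combination theta_sq⟩

theorem intCast_add_mul_theta_re (u v : ℤ) : ((u : EisensteinRing) + v * theta).re = u + v := by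
  simp [theta, re_mul]

theorem intCast_add_mul_theta_im (u v : ℤ) : ((u : EisensteinRing) + v * theta).im = 2 * v := by
  simp [theta, im_mul]
  ring

theorem isSemiprimary_add_mul_theta {u v : ℤ} (hu : ¬ (3 : ℤ) ∣ u) (hv : (3 : ℤ) ∣ v) :
    IsSemiprimary ((u : EisensteinRing) + v * theta) := by
  rw [IsSemiprimary, intCast_add_mul_theta_re, intCast_add_mul_theta_im]
  lia

theorem IsSemiprimary.isCoprime_three (hβ : IsSemiprimary β) : IsCoprime 3 β := by
  have h1 : IsCoprime (3 : ℤ) (nrm β) :=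
    (Int.prime_three.coprime_iff_not_dvd).2 hβ.not_three_dvd_norm
  have h2 := isCoprime_intCast_iff.2 h1
  rw [Int.cast_ofNat] at h2
  exact h2.of_isCoprime_of_dvd_right (dvd_norm β)

theorem IsSemiprimary.isCoprime_theta (hβ : IsSemiprimary β) : IsCoprime theta β :=
  hβ.isCoprime_three.of_isCoprime_of_dvd_left theta_dvd_three

theorem cubicJacobi_theta_intCast {n : ℤ} (hn : ¬ (3 : ℤ) ∣ n) : cubicJacobi theta n = 1 :=
  cubicJacobi_intCast_right_eq_one hn (.inr star_theta)
    (isSemiprimary_intCast.2 hn).isCoprime_theta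

theorem cubicJacobi_intCast_mul_theta {m n : ℤ} (hn : ¬ (3 : ℤ) ∣ n) (h : IsCoprime m n) :
    cubicJacobi ((m : EisensteinRing) * theta) n = 1 := by
  rw [cubicJacobi_mul_left (isSemiprimary_intCast.2 hn), cubicJacobi_theta_intCast hn, mul_one,
    cubicJacobi_intCast_intCast hn (isCoprime_intCast_iff.2 h)]

theorem cubicJacobi_three_eq (hβ : IsSemiprimary β) :
    cubicJacobi 3 β = cubicJacobi theta β ^ 2 := by
  rw [← cubicJacobi_pow_left hβ, theta_sq, cubicJacobi_neg_left hβ]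

/-- If `β = u + 9vθ`, the congruence `u ≡ -9vθ (mod β)` and reciprocity for `u` and `v` give
`χ_β(θ) ^ 5 = 1`. -/
theorem cubicJacobi_theta_eq_one_of_not_dvd {u v : ℤ} (hu : ¬ (3 : ℤ) ∣ u) (hv : ¬ (3 : ℤ) ∣ v)
    (huv : IsCoprime u v) :
    cubicJacobi theta ((u : EisensteinRing) + (9 * v : ℤ) * theta) = 1 := by
  have hβ : IsSemiprimary ((u : EisensteinRing) + (9 * v : ℤ) * theta) :=
    isSemiprimary_add_mul_theta hu ⟨3 * v, by ring⟩
  set β := (u : EisensteinRing) + (9 * v : ℤ) * theta with hβdef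
  have hu3 : IsCoprime (3 : ℤ) u := (Int.prime_three.coprime_iff_not_dvd).2 hu
  have h9v : IsCoprime (9 * v) u :=
    IsCoprime.mul_left (by simpa using hu3.pow_left (m := 2)) huv.symm
  have hβu : IsCoprime β (u : EisensteinRing) := by
    have : IsCoprime (((9 * v : ℤ) : EisensteinRing) * theta) u :=
      (isCoprime_intCast_iff.2 h9v).mul_left (isSemiprimary_intCast.2 hu).isCoprime_theta
    rw [hβdef, add_comm]
    simpa using this.add_mul_left_left 1
  have hβv : IsCoprime β (v : EisensteinRing) := by
    have e : β = (u : EisensteinRing) + v * (9 * theta) := by rw [hβdef]; push_cast; ring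
    rw [e]
    exact (isCoprime_intCast_iff.2 huv).add_mul_left_left (9 * theta)
  have hu1 : cubicJacobi (u : EisensteinRing) β = 1 := by
    rw [← cubicJacobi_intCast_right hβ hu hβu, ← cubicJacobi_intCast_mul_theta hu h9v]
    exact cubicJacobi_congr (isSemiprimary_intCast.2 hu) ⟨1, by rw [hβdef]; ring⟩
  have hv1 : cubicJacobi (v : EisensteinRing) β = 1 := by
    rw [← cubicJacobi_intCast_right hβ hv hβv,
      ← cubicJacobi_intCast_intCast hv (isCoprime_intCast_iff.2 huv)]
    exact cubicJacobi_congr (isSemiprimary_intCast.2 hv)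
      ⟨9 * theta, by rw [hβdef]; push_cast; ring⟩
  have h5 : cubicJacobi theta β ^ 5 = 1 := by
    have h1 : cubicJacobi (u : EisensteinRing) β =
        cubicJacobi (-((v : EisensteinRing) * theta ^ 5)) β := by
      refine cubicJacobi_congr hβ ⟨1, ?_⟩
      rw [hβdef]
      push_cast
      linear_combination ((v : EisensteinRing) * theta ^ 3 - 3 * v * theta) * theta_sq
    rwa [hu1, cubicJacobi_neg_left hβ, cubicJacobi_mul_left hβ, hv1, one_mul,
      cubicJacobi_pow_left hβ, eq_comm] at h1
  have h3 := (isCubicValue_cubicJacobi hβ theta).cube (cubicJacobi_ne_zero hβ hβ.isCoprime_theta)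
  linear_combination (cubicJacobi theta β ^ 3 + 1) * h3 - cubicJacobi theta β * h5

/-- The case that `3` divides `v` is reduced to the previous one on multiplying by `1 + 9rθ` with
`r = N(u + 9vθ)`. -/
theorem cubicJacobi_theta_eq_one_of_isCoprime {u v : ℤ} (hu : ¬ (3 : ℤ) ∣ u)
    (huv : IsCoprime u v) :
    cubicJacobi theta ((u : EisensteinRing) + (9 * v : ℤ) * theta) = 1 := by
  by_cases hv : (3 : ℤ) ∣ v
  swap
  · exact cubicJacobi_theta_eq_one_of_not_dvd hu hv huv
  set r : ℤ := u ^ 2 + 243 * v ^ 2 with hr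
  have hr3 : ¬ (3 : ℤ) ∣ r := by
    intro h
    have : (3 : ℤ) ∣ u ^ 2 := (dvd_add_left ⟨81 * v ^ 2, by ring⟩).1 h
    exact hu (Int.prime_three.dvd_of_dvd_pow this)
  have hβ : IsSemiprimary ((u : EisensteinRing) + (9 * v : ℤ) * theta) :=
    isSemiprimary_add_mul_theta hu ⟨3 * v, by ring⟩
  have hγ : IsSemiprimary (((1 : ℤ) : EisensteinRing) + (9 * r : ℤ) * theta) :=
    isSemiprimary_add_mul_theta (by norm_num) ⟨3 * r, by ring⟩
  have h1 := cubicJacobi_theta_eq_one_of_not_dvd (u := 1) (by norm_num) hr3 isCoprime_one_left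
  have hprod : ((u : EisensteinRing) + (9 * v : ℤ) * theta) *
      (((1 : ℤ) : EisensteinRing) + (9 * r : ℤ) * theta) =
      ((u - 243 * v * r : ℤ) : EisensteinRing) + (9 * (v + r * u) : ℤ) * theta := by
    push_cast
    linear_combination (81 * (v : EisensteinRing) * r) * theta_sq
  have h2 := cubicJacobi_theta_eq_one_of_not_dvd (u := u - 243 * v * r) (v := v + r * u) ?_ ?_ ?_
  · rwa [← hprod, cubicJacobi_mul_right hβ hγ, h1, mul_one] at h2
  · lia
  · intro h
    have : (3 : ℤ) ∣ r * u := (dvd_add_right hv).1 h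
    exact (Int.prime_three.dvd_or_dvd this).elim hr3 hu
  · -- a common divisor of both coordinates divides `r`, hence `u` and `v`
    obtain ⟨s, t, hst⟩ := huv
    refine ⟨s + (243 * s * v - t * u) * u, t + (243 * s * v - t * u) * (243 * v), ?_⟩
    linear_combination hst - (243 * s * v - t * u) * hr

/-- The supplementary law for `√-3` over `u + vθ` with `9 ∣ v`: common factors of `u` and `v` are
rational integers and do not contribute. -/
theorem cubicJacobi_theta_eq_one {u v : ℤ} (hu : ¬ (3 : ℤ) ∣ u) (hv : (9 : ℤ) ∣ v) :
    cubicJacobi theta ((u : EisensteinRing) + v * theta) = 1 := by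
  have hu0 : u ≠ 0 := fun h => hu (by simp [h])
  obtain ⟨v, rfl⟩ := hv
  obtain ⟨g, u', v', hg, hco, hu', hv'⟩ : ∃ g u' v' : ℤ, g ≠ 0 ∧ IsCoprime u' v' ∧
      u = u' * g ∧ v = v' * g := by
    obtain ⟨g, u', v', h1, h2, h3, h4⟩ := Int.exists_gcd_one' (m := u) (n := v)
      (Int.gcd_pos_of_ne_zero_left _ hu0)
    exact ⟨g, u', v', by lia, Int.isCoprime_iff_gcd_eq_one.2 h2, h3, h4⟩
  have hg3 : ¬ (3 : ℤ) ∣ g := fun h => hu (hu' ▸ h.mul_left _)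
  have hu3 : ¬ (3 : ℤ) ∣ u' := fun h => hu (hu' ▸ h.mul_right _)
  have hfac : (u : EisensteinRing) + (9 * v : ℤ) * theta =
      (g : EisensteinRing) * (u' + (9 * v' : ℤ) * theta) := by
    rw [hu', hv']
    push_cast
    ring
  rw [hfac, cubicJacobi_mul_right (isSemiprimary_intCast.2 hg3)
    (isSemiprimary_add_mul_theta hu3 ⟨3 * v', by ring⟩), cubicJacobi_theta_intCast hg3,
    cubicJacobi_theta_eq_one_of_isCoprime hu3 hco, one_mul]

/-! ### The symbol of `Py + 3zθ` over `z² - Dy²` -/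

variable {P D Q q₀ : ℤ} {q₁ : ℕ}

theorem mul_star_add_three_mul_theta (P y z : ℤ) :
    ((P * y + 3 * z * theta : EisensteinRing)) * star (P * y + 3 * z * theta : EisensteinRing) =
      ((P ^ 2 * y ^ 2 + 27 * z ^ 2 : ℤ) : EisensteinRing) := by
  have h3 : star (3 : EisensteinRing) = 3 := by decide
  rw [star_add, star_mul', star_mul', star_mul', star_theta, h3, star_intCast, star_intCast,
    star_intCast]
  push_cast
  linear_combination (-9 * (z : EisensteinRing) ^ 2) * theta_sq

theorem cubicJacobi_eq_one_of_isCoprime_zero {n : ℤ} (hn : IsCoprime n 0) (α : EisensteinRing) :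
    cubicJacobi α (n : EisensteinRing) = 1 := by
  rw [isCoprime_zero_right] at hn
  refine cubicJacobi_of_isUnit (isSemiprimary_intCast.2 fun h => ?_)
    (hn.map (Int.castRingHom EisensteinRing)) _
  exact Int.prime_three.not_isUnit (isUnit_of_dvd_unit h hn)

/-- The evaluation of the symbol when `Py + 3zθ` is a product of powers of `3` and `θ` and of a
semiprimary `β`. Reciprocity turns the symbol into that of `n = z² - Dy²` over `β`, where
`27 n ≡ -Qy²`, and `Q` is a cube up to a power of `2`. -/
theorem cubicJacobi_eq_one_of_eq_mul_semiprimary (hQ : Q = P ^ 2 + 27 * D)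
    (hQ' : Q = 2 ^ q₁ * q₀ ^ 3) {y z : ℤ}
    (hn : IsCoprime (z ^ 2 - D * y ^ 2) (3 * Q * y)) {β : EisensteinRing}
    (hβ : IsSemiprimary β) {j k : ℕ}
    (hα : (P * y + 3 * z * theta : EisensteinRing) = 3 ^ k * theta ^ j * β)
    (hθ : (3 : ℤ) ∣ y → cubicJacobi theta β = 1) :
    cubicJacobi (P * y + 3 * z * theta) ((z ^ 2 - D * y ^ 2 : ℤ) : EisensteinRing) = 1 := by
  rcases eq_or_ne y 0 with rfl | hy
  · exact cubicJacobi_eq_one_of_isCoprime_zero (by simpa using hn) _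
  set n := z ^ 2 - D * y ^ 2 with hndef
  set α : EisensteinRing := P * y + 3 * z * theta with hαdef
  have hn3 : ¬ (3 : ℤ) ∣ n := by
    rw [← Int.prime_three.coprime_iff_not_dvd]
    exact (hn.of_isCoprime_of_dvd_right ⟨Q * y, by ring⟩).symm
  have hnQ : IsCoprime n Q := hn.of_isCoprime_of_dvd_right ⟨3 * y, by ring⟩
  have hny : IsCoprime n y := hn.of_isCoprime_of_dvd_right ⟨3 * Q, by ring⟩
  have hn' := isSemiprimary_intCast.2 hn3
  have hnorm : α * star α = ((27 * n + Q * y ^ 2 : ℤ) : EisensteinRing) := by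
    rw [hαdef, mul_star_add_three_mul_theta, hndef, hQ]
    congr 1
    ring
  have hβα : β ∣ α := ⟨3 ^ k * theta ^ j, by rw [hα]; ring⟩
  -- over an integer prime to `3` the factors `3` and `θ` do not contribute
  have hred {m : ℤ} (hm : ¬ (3 : ℤ) ∣ m) : cubicJacobi α m = cubicJacobi β m := by
    have hm' := isSemiprimary_intCast.2 hm
    have h3 : cubicJacobi 3 (m : EisensteinRing) = 1 := by
      rw [cubicJacobi_three_eq hm', cubicJacobi_theta_intCast hm, one_pow]
    rw [hα, cubicJacobi_mul_left hm', cubicJacobi_mul_left hm', cubicJacobi_pow_left hm',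
      cubicJacobi_pow_left hm', h3, cubicJacobi_theta_intCast hm]
    simp
  have hαn : IsCoprime α (n : EisensteinRing) := by
    have h1 : IsCoprime (27 * n + Q * y ^ 2) n := by
      have := (hnQ.mul_right (hny.pow_right (n := 2))).symm.add_mul_left_left 27
      rwa [mul_comm n, add_comm] at this
    exact (isCoprime_intCast_iff.2 h1).of_isCoprime_of_dvd_left ⟨star α, hnorm.symm⟩
  have hβn := hαn.of_isCoprime_of_dvd_left hβα
  -- the contribution of `y`
  have hyβ : cubicJacobi y β = 1 := by
    obtain ⟨y', hy', hyy⟩ := (Int.finiteMultiplicity_iff.2 ⟨by decide, hy⟩ :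
      FiniteMultiplicity (3 : ℤ) y).exists_eq_pow_mul_and_not_dvd
    have hzy : IsCoprime z y' := by
      have h1 : IsCoprime (z ^ 2) y := by
        have := hny.add_mul_left_left (D * y)
        rwa [hndef, show z ^ 2 - D * y ^ 2 + y * (D * y) = z ^ 2 by ring] at this
      have h2 := (IsCoprime.pow_left_iff two_pos).1 h1
      exact h2.of_isCoprime_of_dvd_right ⟨_, by rw [mul_comm]; exact hy'⟩
    have h3y : IsCoprime 3 y' := Int.prime_three.coprime_iff_not_dvd.2 hyy
    have hcong : (y' : EisensteinRing) ∣ α - ((3 * z : ℤ) : EisensteinRing) * theta := by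
      refine ⟨P * 3 ^ multiplicity 3 y, ?_⟩
      rw [hαdef]
      nth_rw 1 [hy']
      push_cast
      ring
    have hα1 : cubicJacobi α y' = 1 := by
      rw [cubicJacobi_congr (isSemiprimary_intCast.2 hyy) hcong]
      exact cubicJacobi_intCast_mul_theta hyy (h3y.mul_left hzy)
    have hβy : IsCoprime β (y' : EisensteinRing) := by
      refine IsCoprime.of_isCoprime_of_dvd_left ?_ hβα
      have h1 : IsCoprime (((3 * z : ℤ) : EisensteinRing) * theta) y' :=
        (isCoprime_intCast_iff.2 (h3y.mul_left hzy)).mul_left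
          (isSemiprimary_intCast.2 hyy).isCoprime_theta
      obtain ⟨c, hc⟩ := hcong
      rw [sub_eq_iff_eq_add'] at hc
      rw [hc]
      exact h1.add_mul_left_left c
    have h3 : cubicJacobi (3 ^ multiplicity 3 y) β = 1 := by
      by_cases h : (3 : ℤ) ∣ y
      · rw [cubicJacobi_pow_left hβ, cubicJacobi_three_eq hβ, hθ h]
        simp
      · rw [multiplicity_eq_zero.2 h, pow_zero, cubicJacobi_one_left hβ]
    rw [hy']
    push_cast
    rw [cubicJacobi_mul_left hβ, h3, one_mul, ← cubicJacobi_intCast_right hβ hyy hβy, ← hred hyy,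
      hα1]
  -- the contribution of the power of `2`: if it is present, then `α ≡ 1 (mod 2)`
  have h2β : cubicJacobi (2 ^ q₁) β = 1 := by
    rcases Nat.eq_zero_or_pos q₁ with rfl | hq
    · rw [pow_zero, cubicJacobi_one_left hβ]
    have h2Q : (2 : ℤ) ∣ Q := hQ' ▸ (dvd_pow_self 2 hq.ne').mul_right _
    have hn2 : ¬ (2 : ℤ) ∣ n := fun h => by
      have := hnQ.isUnit_of_dvd' h h2Q
      rw [Int.isUnit_iff] at this
      lia
    have hodd : (2 : ℤ) ∣ P * y + 3 * z - 1 := by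
      rw [hQ] at h2Q
      rw [hndef] at hn2
      have hd (t : ℤ) : t % 2 = 0 ∨ t % 2 = 1 := Int.emod_two_eq_zero_or_one t
      have e1 := hd P
      have e2 := hd D
      have e3 := hd y
      have e4 := hd z
      rw [Int.dvd_iff_emod_eq_zero] at *
      rcases e1 with e1 | e1 <;> rcases e2 with e2 | e2 <;> rcases e3 with e3 | e3 <;>
        rcases e4 with e4 | e4 <;>
        simp [Int.add_emod, Int.sub_emod, Int.mul_emod, pow_two, e1, e2, e3, e4] at h2Q hn2 ⊢
    obtain ⟨t, ht⟩ := hodd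
    have h3 : ¬ (3 : ℤ) ∣ 2 := by norm_num
    have hα2 : α = 1 + ((2 : ℤ) : EisensteinRing) * (t + 3 * z * w) := by
      have : (P : EisensteinRing) * y + 3 * z - 1 = 2 * t := by exact_mod_cast ht
      rw [hαdef, theta]
      push_cast
      linear_combination this
    have hcop : IsCoprime β ((2 : ℤ) : EisensteinRing) := by
      refine IsCoprime.of_isCoprime_of_dvd_left ?_ hβα
      rw [hα2]
      exact isCoprime_one_left.add_mul_left_left _
    have : cubicJacobi ((2 : ℤ) : EisensteinRing) β = 1 := by
      rw [← cubicJacobi_intCast_right hβ h3 hcop, ← hred h3,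
        cubicJacobi_congr (isSemiprimary_intCast.2 h3) ⟨t + 3 * z * w, sub_eq_iff_eq_add'.2 hα2⟩,
        cubicJacobi_one_left (isSemiprimary_intCast.2 h3)]
    rw [cubicJacobi_pow_left hβ]
    rw [Int.cast_ofNat] at this
    rw [this, one_pow]
  have h27 : cubicJacobi (27 * (n : EisensteinRing)) β = cubicJacobi n β := by
    rw [cubicJacobi_mul_left hβ, show (27 : EisensteinRing) = 3 ^ 3 by norm_num,
      cubicJacobi_cube hβ (cubicJacobi_ne_zero hβ hβ.isCoprime_three), one_mul]
  have hnq : cubicJacobi n β = cubicJacobi ((q₀ : EisensteinRing) ^ 3) β := by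
    have h1 : cubicJacobi (27 * (n : EisensteinRing)) β =
        cubicJacobi (-(2 ^ q₁ * (q₀ : EisensteinRing) ^ 3 * y ^ 2)) β := by
      refine cubicJacobi_congr hβ (hβα.trans ⟨star α, ?_⟩)
      rw [hnorm, hQ']
      push_cast
      ring
    rw [← h27, h1, cubicJacobi_neg_left hβ, cubicJacobi_mul_left hβ, cubicJacobi_mul_left hβ,
      cubicJacobi_pow_left hβ (y : EisensteinRing), hyβ, h2β]
    simp
  have hn0 : cubicJacobi n β ≠ 0 := cubicJacobi_ne_zero hβ hβn.symm
  have hq0 : cubicJacobi q₀ β ≠ 0 := by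
    intro h
    rw [hnq, cubicJacobi_pow_left hβ, h] at hn0
    simp at hn0
  rw [hred hn3, cubicJacobi_intCast_right hβ hn3 hβn, hnq, cubicJacobi_cube hβ hq0]

/-! ### Composition of `z + y√D` with `z₀ + √D` -/

/-- The auxiliary `z₀ = c r n`, with a prescribed factor `c n`, for which `z₀² - D` is prime to
`m`. -/
theorem exists_isCoprime_sq_sub {n m c : ℤ} (hm : m ≠ 0) (hnm : IsCoprime n m)
    (hcD : IsCoprime c D) : ∃ r : ℤ, IsCoprime ((c * r * n) ^ 2 - D) m := by
  classical
  -- `r` is the product of the primes dividing `m` but not `D`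
  set S := m.natAbs.primeFactors.filter fun p : ℕ => ¬ (p : ℤ) ∣ D with hS
  refine ⟨∏ p ∈ S, (p : ℤ), isCoprime_of_prime_dvd (fun h => hm h.2) fun p hp hpd hpm => ?_⟩
  have hpn : ¬ p ∣ n := fun h => hp.not_isUnit (hnm.isUnit_of_dvd' h hpm)
  by_cases hpD : p ∣ D
  · have h1 : p ∣ c * (∏ p ∈ S, (p : ℤ)) * n := hp.dvd_of_dvd_pow ((dvd_sub_left hpD).1 hpd)
    have h2 := (hp.dvd_or_dvd h1).resolve_right hpn
    rcases hp.dvd_or_dvd h2 with h3 | h3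
    · exact hp.not_isUnit (hcD.isUnit_of_dvd' h3 hpD)
    · obtain ⟨l, hl, hpl⟩ := hp.exists_mem_finset_dvd h3
      obtain ⟨hl1, hl2⟩ := Finset.mem_filter.1 hl
      have hlp := Nat.prime_iff_prime_int.1 (Nat.prime_of_mem_primeFactors hl1)
      exact hl2 ((hp.associated_of_dvd hlp hpl).symm.dvd.trans hpD)
  · refine hpD ((dvd_sub_right ?_).1 hpd)
    have hmem : p.natAbs ∈ S := by
      refine Finset.mem_filter.2 ⟨Nat.mem_primeFactors.2 ⟨Int.prime_iff_natAbs_prime.1 hp,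
        Int.natAbs_dvd_natAbs.2 hpm, by simpa using hm⟩, fun h => hpD (Int.natAbs_dvd.1 h)⟩
    have h1 : p ∣ ∏ p ∈ S, (p : ℤ) :=
      (Int.dvd_natAbs.2 dvd_rfl).trans (Finset.dvd_prod_of_mem _ hmem)
    exact ((h1.mul_left c).mul_right n).trans (dvd_pow_self _ two_ne_zero)

/-- Multiplication of `z + y√D` by an auxiliary `z₀ + √D` with `z₀ ≡ 0 (mod z² - Dy²)`. To each
`z + y√D` belongs `Py + 3zθ`. Modulo `z² - Dy²` and modulo `z₀² - D` the element belonging to the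
product agrees up to rational factors with the one belonging to the respective factor, so the
symbol is multiplicative. -/
theorem cubicJacobi_eq_one_of_composition {y z z₀ : ℤ} (hn : IsCoprime (z ^ 2 - D * y ^ 2)
      (3 * D * Q * y)) (hz₀ : z ^ 2 - D * y ^ 2 ∣ z₀) (hn₀ : IsCoprime (z₀ ^ 2 - D) (3 * Q))
    (h₀ : cubicJacobi (P + 3 * z₀ * theta) ((z₀ ^ 2 - D : ℤ) : EisensteinRing) = 1)
    (h₁ : IsCoprime ((z * z₀ + y * D) ^ 2 - D * (z + y * z₀) ^ 2) (3 * Q * (z + y * z₀)) →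
      cubicJacobi (P * (z + y * z₀ : ℤ) + 3 * (z * z₀ + y * D : ℤ) * theta)
        (((z * z₀ + y * D) ^ 2 - D * (z + y * z₀) ^ 2 : ℤ) : EisensteinRing) = 1) :
    cubicJacobi (P * y + 3 * z * theta) ((z ^ 2 - D * y ^ 2 : ℤ) : EisensteinRing) = 1 := by
  have hprod : (z * z₀ + y * D) ^ 2 - D * (z + y * z₀) ^ 2 =
      (z ^ 2 - D * y ^ 2) * (z₀ ^ 2 - D) := by ring
  rw [hprod] at h₁
  obtain ⟨t, ht⟩ := hz₀
  set n := z ^ 2 - D * y ^ 2 with hndef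
  set n₀ := z₀ ^ 2 - D with hn₀def
  set y' := z + y * z₀ with hy'def
  set z' := z * z₀ + y * D with hz'def
  have hn3Q : IsCoprime n (3 * Q) := hn.of_isCoprime_of_dvd_right ⟨D * y, by ring⟩
  have hnD : IsCoprime n D := hn.of_isCoprime_of_dvd_right ⟨3 * Q * y, by ring⟩
  have hny : IsCoprime n y := hn.of_isCoprime_of_dvd_right ⟨3 * D * Q, by ring⟩
  have hn3 : ¬ (3 : ℤ) ∣ n := by
    rw [← Int.prime_three.coprime_iff_not_dvd]
    exact (hn3Q.of_isCoprime_of_dvd_right ⟨Q, rfl⟩).symm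
  have hn₀3 : ¬ (3 : ℤ) ∣ n₀ := by
    rw [← Int.prime_three.coprime_iff_not_dvd]
    exact (hn₀.of_isCoprime_of_dvd_right ⟨Q, rfl⟩).symm
  have hnz : IsCoprime n z := by
    have h1 : IsCoprime n (D * y ^ 2) := hnD.mul_right hny.pow_right
    have h2 : IsCoprime n (z ^ 2) := by
      have := h1.add_mul_left_right 1
      rwa [hndef, show D * y ^ 2 + (z ^ 2 - D * y ^ 2) * 1 = z ^ 2 by ring] at this
    exact (IsCoprime.pow_right_iff two_pos).1 h2
  have hny' : IsCoprime n y' := by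
    rw [hy'def, ht, show z + y * (n * t) = z + n * (y * t) by ring]
    exact hnz.add_mul_left_right _
  have hn₀y' : IsCoprime n₀ y' := by
    have h1 := hny'.add_mul_right_left (y * z₀ - z)
    rw [show n + (y * z₀ - z) * y' = y ^ 2 * n₀ by rw [hndef, hy'def, hn₀def]; ring] at h1
    exact h1.of_isCoprime_of_dvd_left ⟨y ^ 2, mul_comm _ _⟩
  have hn' := isSemiprimary_intCast.2 hn3
  have hn₀' := isSemiprimary_intCast.2 hn₀3
  have hmain := h₁ ((hn3Q.mul_right hny').mul_left (hn₀.mul_right hn₀y'))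
  rw [Int.cast_mul, cubicJacobi_mul_right hn' hn₀'] at hmain
  have e₀ : cubicJacobi (P * y' + 3 * z' * theta) (n₀ : EisensteinRing) = 1 := by
    rw [← h₀, ← one_mul (cubicJacobi (P + _) _),
      ← cubicJacobi_intCast_intCast hn₀3 (isCoprime_intCast_iff.2 hn₀y'.symm),
      ← cubicJacobi_mul_left hn₀']
    refine cubicJacobi_congr hn₀' ⟨-(3 * y * theta), ?_⟩
    rw [hy'def, hz'def, hn₀def]
    push_cast
    ring
  have e₁ : cubicJacobi (P * y' + 3 * z' * theta) (n : EisensteinRing) =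
      cubicJacobi (P * y + 3 * z * theta) (n : EisensteinRing) := by
    rw [← one_mul (cubicJacobi (P * y' + _) _), ← one_mul (cubicJacobi (P * y + _) _)]
    nth_rw 1 [← cubicJacobi_intCast_intCast hn3 (isCoprime_intCast_iff.2 hny.symm)]
    rw [← cubicJacobi_intCast_intCast hn3 (isCoprime_intCast_iff.2 hny'.symm),
      ← cubicJacobi_mul_left hn', ← cubicJacobi_mul_left hn']
    refine cubicJacobi_congr hn' ⟨-(3 * theta), ?_⟩
    rw [hy'def, hz'def, hndef]
    push_cast
    ring
  rwa [e₀, mul_one, e₁] at hmain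

/-! ### Triviality of the symbol -/

/-- The case `3 ∤ P`. If `3 ∣ y`, then composing with `z₀ + √D` makes `y` prime to `3`. -/
theorem cubicJacobi_eq_one_of_three_not_dvd (hP : ¬ (3 : ℤ) ∣ P) (hQ : Q = P ^ 2 + 27 * D)
    (hQ' : Q = 2 ^ q₁ * q₀ ^ 3) {y z : ℤ} (hQ0 : Q ≠ 0)
    (hn : IsCoprime (z ^ 2 - D * y ^ 2) (3 * D * Q * y)) :
    cubicJacobi (P * y + 3 * z * theta) ((z ^ 2 - D * y ^ 2 : ℤ) : EisensteinRing) = 1 := by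
  -- the case `3 ∤ y`, where `Py + 3zθ` is itself semiprimary
  have key {y z : ℤ} (h3 : ¬ (3 : ℤ) ∣ y) (hn : IsCoprime (z ^ 2 - D * y ^ 2) (3 * Q * y)) :
      cubicJacobi (P * y + 3 * z * theta) ((z ^ 2 - D * y ^ 2 : ℤ) : EisensteinRing) = 1 := by
    have hPy : ¬ (3 : ℤ) ∣ P * y := fun h => (Int.prime_three.dvd_or_dvd h).elim hP h3
    have hβ := isSemiprimary_add_mul_theta hPy (dvd_mul_right 3 z)
    push_cast at hβ
    exact cubicJacobi_eq_one_of_eq_mul_semiprimary hQ hQ' hn hβ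
      (j := 0) (k := 0) (by ring) fun h => absurd h h3
  by_cases h3 : (3 : ℤ) ∣ y
  swap
  · exact key h3 (hn.of_isCoprime_of_dvd_right ⟨D, by ring⟩)
  have hn3Q : IsCoprime (z ^ 2 - D * y ^ 2) (3 * Q) :=
    hn.of_isCoprime_of_dvd_right ⟨D * y, by ring⟩
  obtain ⟨r, hr⟩ := exists_isCoprime_sq_sub (c := 1) (D := D) (by simpa using hQ0) hn3Q
    isCoprime_one_left
  refine cubicJacobi_eq_one_of_composition hn ⟨1 * r, mul_comm _ _⟩ hr ?_ (key ?_)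
  · have := key (y := 1) (z := 1 * r * (z ^ 2 - D * y ^ 2)) (by norm_num) (by simpa using hr)
    simpa using this
  · intro h
    have hz : (3 : ℤ) ∣ z := (dvd_add_left (h3.mul_right _)).1 h
    have hn3 : (3 : ℤ) ∣ z ^ 2 - D * y ^ 2 :=
      dvd_sub (hz.trans (dvd_pow_self _ two_ne_zero))
        ((h3.trans (dvd_pow_self _ two_ne_zero)).mul_left _)
    exact Int.prime_three.not_isUnit (hn3Q.isUnit_of_dvd' hn3 (dvd_mul_right _ _))

/-- The case `27 ∣ P`. If `3 ∣ z`, then composing with `z₀ + √D` makes `z` prime to `3`, and `z₀` is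
taken so divisible by `3` that `P + 3z₀θ` is a power of `3` times a semiprimary element. -/
theorem cubicJacobi_eq_one_of_dvd (hP : (27 : ℤ) ∣ P) (hQ : Q = P ^ 2 + 27 * D)
    (hQ' : Q = 2 ^ q₁ * q₀ ^ 3) {y z : ℤ} (hQ0 : Q ≠ 0)
    (hn : IsCoprime (z ^ 2 - D * y ^ 2) (3 * D * Q * y)) :
    cubicJacobi (P * y + 3 * z * theta) ((z ^ 2 - D * y ^ 2 : ℤ) : EisensteinRing) = 1 := by
  -- the case `3 ∤ z`, where `Py + 3zθ = 3θ(z - (P / 9)yθ)`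
  have key {y z : ℤ} (h3 : ¬ (3 : ℤ) ∣ z)
      (hn : IsCoprime (z ^ 2 - D * y ^ 2) (3 * Q * y)) :
      cubicJacobi (P * y + 3 * z * theta) ((z ^ 2 - D * y ^ 2 : ℤ) : EisensteinRing) = 1 := by
    obtain ⟨p, hp⟩ := hP
    have hβ := isSemiprimary_add_mul_theta h3 (v := -(3 * p * y)) ⟨-(p * y), by ring⟩
    refine cubicJacobi_eq_one_of_eq_mul_semiprimary hQ hQ' hn hβ (j := 1) (k := 1) ?_ ?_
    · rw [hp]
      push_cast
      linear_combination (9 * (p : EisensteinRing) * y) * theta_sq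
    · rintro ⟨t, ht⟩
      exact cubicJacobi_theta_eq_one h3 ⟨-(p * t), by rw [ht]; ring⟩
  by_cases h3 : (3 : ℤ) ∣ z
  swap
  · exact key h3 (hn.of_isCoprime_of_dvd_right ⟨D, by ring⟩)
  have hn3Q : IsCoprime (z ^ 2 - D * y ^ 2) (3 * Q) :=
    hn.of_isCoprime_of_dvd_right ⟨D * y, by ring⟩
  have hn3 : ¬ (3 : ℤ) ∣ z ^ 2 - D * y ^ 2 := fun h =>
    Int.prime_three.not_isUnit (hn3Q.isUnit_of_dvd' h (dvd_mul_right _ _))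
  have hDy : ¬ (3 : ℤ) ∣ D * y ^ 2 := fun h =>
    hn3 (dvd_sub (h3.trans (dvd_pow_self _ two_ne_zero)) h)
  have hD3 : ¬ (3 : ℤ) ∣ D := fun h => hDy (h.mul_right _)
  have hy3 : ¬ (3 : ℤ) ∣ y := fun h => hDy ((h.trans (dvd_pow_self _ two_ne_zero)).mul_left _)
  have hn' := isSemiprimary_intCast.2 hn3
  rcases eq_or_ne P 0 with rfl | hP0
  · -- here `Py + 3zθ` is a rational multiple of `θ`
    have hnz : IsCoprime (3 * z) (z ^ 2 - D * y ^ 2) := by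
      refine (Int.prime_three.coprime_iff_not_dvd.2 hn3).mul_left ?_
      have h1 : IsCoprime (z ^ 2 - D * y ^ 2) (D * y ^ 2) :=
        (hn.of_isCoprime_of_dvd_right ⟨3 * Q * y, by ring⟩).mul_right
          (hn.of_isCoprime_of_dvd_right ⟨3 * D * Q, by ring⟩).pow_right
      have h2 := h1.add_mul_left_right 1
      rw [show D * y ^ 2 + (z ^ 2 - D * y ^ 2) * 1 = z ^ 2 by ring] at h2
      exact ((IsCoprime.pow_right_iff two_pos).1 h2).symm
    have := cubicJacobi_intCast_mul_theta hn3 hnz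
    push_cast at this ⊢
    simpa using this
  -- `z₀` is divisible by a higher power of `3` than `P`
  obtain ⟨p, hp, hp3⟩ := (Int.finiteMultiplicity_iff.2 ⟨by decide, hP0⟩ :
    FiniteMultiplicity (3 : ℤ) P).exists_eq_pow_mul_and_not_dvd
  set k := multiplicity 3 P
  obtain ⟨r, hr⟩ := exists_isCoprime_sq_sub (c := 3 ^ (k + 1)) (D := D) (by simpa using hQ0) hn3Q
    ((Int.prime_three.coprime_iff_not_dvd.2 hD3).pow_left)
  obtain ⟨z₀, hz₀⟩ : ∃ z₀, z₀ = 3 ^ (k + 1) * r * (z ^ 2 - D * y ^ 2) := ⟨_, rfl⟩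
  rw [← hz₀] at hr
  refine cubicJacobi_eq_one_of_composition hn ⟨3 ^ (k + 1) * r, by rw [hz₀, mul_comm]⟩ hr ?_
    (key ?_)
  · have hβ := isSemiprimary_add_mul_theta hp3 
      (v := 9 * (r * (z ^ 2 - D * y ^ 2))) ⟨3 * (r * (z ^ 2 - D * y ^ 2)), by ring⟩
    have := cubicJacobi_eq_one_of_eq_mul_semiprimary hQ hQ' (y := 1) (z := z₀)
      (by simpa using hr) hβ (j := 0) (k := k) ?_ fun h => absurd h (by norm_num)
    · simpa using this
    · rw [hz₀]
      nth_rw 1 [hp]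
      push_cast
      ring
  · intro h
    have : (3 : ℤ) ∣ y * D := (dvd_add_right (h3.mul_right _)).1 h
    exact (Int.prime_three.dvd_or_dvd this).elim hy3 hD3

/-- The symbol of `Py + 3zθ` over `z² - Dy²` is trivial. -/
theorem cubicJacobi_add_three_mul_theta (hP : ¬ (3 : ℤ) ∣ P ∨ (27 : ℤ) ∣ P)
    (hQ : Q = P ^ 2 + 27 * D) (hQ' : Q = 2 ^ q₁ * q₀ ^ 3) {y z : ℤ}
    (hn : IsCoprime (z ^ 2 - D * y ^ 2) (3 * D * Q * y)) :
    cubicJacobi (P * y + 3 * z * theta) ((z ^ 2 - D * y ^ 2 : ℤ) : EisensteinRing) = 1 := by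
  rcases eq_or_ne Q 0 with h0 | hQ0
  · exact cubicJacobi_eq_one_of_isCoprime_zero (by simpa [h0] using hn) _
  rcases hP with hP | hP
  · exact cubicJacobi_eq_one_of_three_not_dvd hP hQ hQ' hQ0 hn
  · exact cubicJacobi_eq_one_of_dvd hP hQ hQ' hQ0 hn

end EisensteinRing

theorem theorem2p1 (P D Q : ℤ) (hP : ¬ (3 : ℤ) ∣ P ∨ (27 : ℤ) ∣ P)
    (hQ : Q = P ^ 2 + 27 * D)
    (q₀ : ℤ) (q₁ : ℕ) (hq₁ : q₁ = 0 ∨ q₁ = 1 ∨ q₁ = 2)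
    (hQ' : Q = 2 ^ q₁ * q₀ ^ 3)
    (a b c x y : ℤ)
    (hcop : Int.gcd (a * (a * x ^ 2 + 2 * b * x * y + c * y ^ 2)) (3 * D * Q * y) = 1)
    (hD : b ^ 2 - a * c = D) :
    EisensteinRing.cubicJacobi
        ((P : EisensteinRing) * (y : EisensteinRing)
          + 3 * ((a : EisensteinRing) * (x : EisensteinRing)
            + (b : EisensteinRing) * (y : EisensteinRing)) * (1 + 2 * EisensteinRing.w))
        ((a * x ^ 2 + 2 * b * x * y + c * y ^ 2 : ℤ) : EisensteinRing)
      = EisensteinRing.cubicJacobi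
        ((P : EisensteinRing) - 3 * (b : EisensteinRing) * (1 + 2 * EisensteinRing.w))
        (a : EisensteinRing) := by
  open EisensteinRing in
  rw [← Int.isCoprime_iff_gcd_eq_one] at hcop
  set f := a * x ^ 2 + 2 * b * x * y + c * y ^ 2 with hf
  have haf : (a * x + b * y) ^ 2 - D * y ^ 2 = a * f := by rw [hf, ← hD]; ring
  have hmain := cubicJacobi_add_three_mul_theta hP hQ hQ' (haf ▸ hcop)
  have hcop3 : IsCoprime (a * f) 3 := hcop.of_isCoprime_of_dvd_right ⟨D * Q * y, by ring⟩
  have h3 {m : ℤ} (hm : m ∣ a * f) : ¬ (3 : ℤ) ∣ m := fun h =>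
    Int.prime_three.not_isUnit (hcop3.isUnit_of_dvd' (h.trans hm) dvd_rfl)
  have ha3 := h3 (dvd_mul_right a f)
  have ha := isSemiprimary_intCast.2 ha3
  have hfs := isSemiprimary_intCast.2 (h3 (dvd_mul_left f a))
  have hya : IsCoprime y a :=
    ((hcop.of_isCoprime_of_dvd_right ⟨3 * D * Q, mul_comm _ _⟩).of_isCoprime_of_dvd_left
      (dvd_mul_right a f)).symm
  rw [haf, Int.cast_mul, cubicJacobi_mul_right ha hfs] at hmain
  push_cast at hmain
  set γ : EisensteinRing := P - 3 * b * (1 + 2 * w) with hγ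
  have hstar : star γ = P + 3 * b * theta := by
    have e3 : star (3 : EisensteinRing) = 3 := by decide
    rw [hγ, ← theta, star_sub, star_mul', star_mul', star_intCast, star_intCast, e3, star_theta]
    ring
  -- modulo `a` the element on the left is `y` times the conjugate of `γ`
  have hγa : cubicJacobi (P * y + 3 * (a * x + b * y) * theta) (a : EisensteinRing) =
      star (cubicJacobi γ a) := by
    rw [← cubicJacobi_star ha, star_intCast, hstar,
      ← one_mul (cubicJacobi (P + 3 * b * theta) (a : EisensteinRing)),
      ← cubicJacobi_intCast_intCast ha3 (isCoprime_intCast_iff.2 hya), ← cubicJacobi_mul_left ha]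
    exact cubicJacobi_congr ha ⟨3 * x * theta, by ring⟩
  have hval := isCubicValue_cubicJacobi ha γ
  rw [hγa, hval.star_eq_sq] at hmain
  have hcube := hval.cube fun h => by rw [h] at hmain; simp at hmain
  rw [← theta]
  linear_combination cubicJacobi γ a * hmain -
    cubicJacobi (P * y + 3 * (a * x + b * y) * theta) (f : EisensteinRing) * hcube
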